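/- Let $\lambda^*,\mu>0$ and let $Y$ be a random batch size with values in $\{1,\dots,b\}$ such that $\lambda^*<\mu\,\mathbb{E}Y$. Consider single-server queues with i.i.d. inter-arrival times of mean $1/\lambda^*$, in which service completions occur at rate $\mu$ while the system is not empty; each completion removes an independent batch distributed as $Y$, or all customers present if there are fewer than $Y$ of them, in order of arrival. In the $E_k/M^Y/1$-queue ($k\ge 1$) an inter-arrival time consists of $k$ independent exponential phases of rate $k\lambda^*$; the queue is the Markov process on the states $(m,i)$, $m\ge 0$, $0\le i<k$, where $m$ is the number of customers in the system and $i$ the number of completed arrival phases. In the $D/M^Y/1$-queue every inter-arrival time equals $1/\lambda^*$; the queue is the Markov process of the pair (number of customers, time since the last arrival). If $Y\equiv 1$ these are the $E_k/M/1$- and $D/M/1$-queues. Each of these Markov processes has a unique stationary distribution, and in each queue the embedded chain of the number of customers found by successive arriving customers has a unique stationary distribution. Let $\bar\pi^k$ and $\bar\pi^D$ be the laws of the number of customers in the system under the stationary distributions of the $E_k/M^Y/1$- and the $D/M^Y/1$-queue. Let $L_k,L_D$ and $V_k,V_D$ be the means and the variances of these laws, and let $W_k,W_D$ be the expected sojourn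 times of a customer who finds upon arrival a number of customers distributed according to the stationary distribution of the embedded chain. All these quantities are finite, and the following hold. (i) If $\mathbb{P}\{Y=1\}=1$, then $\bar\pi^D\preceq_{st}\bar\pi^{k+1}\preceq_{st}\bar\pi^k$ for all $k\ge1$, where $p\preceq_{st}q$ means that $\sum_{m\ge M}p_m\le\sum_{m\ge M}q_m$ for all $M\ge0$. (ii) For every $Y$ as above (in particular for $Y\equiv1$), $L_{k+1}\le L_k$, $W_{k+1}\le W_k$ and $V_{k+1}\le V_k$ for all $k\ge1$, and $L_k\to L_D$, $W_k\to W_D$, $V_k\to V_D$ as $k\to\infty$. -/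

import Mathlib

open MeasureTheory ProbabilityTheory Filter
open scoped ENNReal NNReal Topology

noncomputable section

namespace BatchQueue

/-- The law of `Y₁ + ⋯ + Y_j` for i.i.d. batch sizes with law `Y`. -/
def batchSum (Y : Measure ℕ) : ℕ → Measure ℕ
  | 0 => Measure.dirac 0
  | j + 1 => Measure.conv (batchSum Y j) Y

/-- The law of the total size of the batches that a server which never stops completes in a time
interval of length `t`: batches are completed at the points of a Poisson process of rate `mu`. -/
def servedLaw (mu : ℝ) (Y : Measure ℕ) (t : ℝ) : Measure ℕ :=
  (poissonMeasure (mu * t).toNNReal).bind (batchSum Y)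

/-- The law of the number of customers that are still present after a time `t` without arrivals,
when it was `n` at the start. A service completion removes a batch of size `Y`, or everybody if
fewer than `Y` customers are present, and completions in an empty system do nothing; hence this
number is `max (n - S) 0` with `S` distributed as `servedLaw mu Y t` (subtraction in `ℕ` is
truncated). -/
def afterService (mu : ℝ) (Y : Measure ℕ) (n : ℕ) (t : ℝ) : Measure ℕ :=
  (servedLaw mu Y t).map (fun s => n - s)

/-! ### The queue with Erlang inter-arrival times

A state `(m, i)` says that `m` customers are present and that the customer who will arrive next has
completed `i` of the `k` arrival phases. -/

/-- The state reached from a state by the completion of an arrival phase. -/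
def nextPhase {k : ℕ} (s : ℕ × Fin k) : ℕ × Fin k :=
  if h : (s.2 : ℕ) + 1 < k then (s.1, ⟨s.2 + 1, h⟩)
  else (s.1 + 1, ⟨0, s.2.pos⟩)

/-- The infinitesimal generator of the queue with Erlang inter-arrival times that consist of `k`
exponential phases of rate `k * lam` each (mean inter-arrival time `1 / lam`), and batch services of
rate `mu`. -/
def erlangGenerator (lam mu : ℝ) (Y : Measure ℕ) (k : ℕ) (s s' : ℕ × Fin k) : ℝ :=
  k * lam * ((if s' = nextPhase s then 1 else 0) - (if s' = s then 1 else 0))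
    + mu * ((if s'.2 = s.2 then (Y.map (fun j => s.1 - j)).real {s'.1} else 0)
        - (if s' = s then 1 else 0))

/-- `P` is a stationary distribution of the Markov process with generator `erlangGenerator`:
a probability distribution with `P Q = 0`. -/
def IsErlangStationary (lam mu : ℝ) (Y : Measure ℕ) (k : ℕ) (P : Measure (ℕ × Fin k)) : Prop :=
  IsProbabilityMeasure P ∧
    ∀ s', HasSum (fun s => P.real {s} * erlangGenerator lam mu Y k s s') 0

/-! ### The queue with deterministic inter-arrival times

A state `(n, a)` says that `n` customers are present and that the time since the last arrival
is `a`; here `0 ≤ a < T`, where `T` is the inter-arrival time. -/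

/-- The law of the number of customers just after the arrival number `i + 1`, when the process
starts in `(n, a)`. The arrivals take place at the times `T - a, 2 * T - a, …`. -/
def afterArrival (mu : ℝ) (Y : Measure ℕ) (T : ℝ) (n : ℕ) (a : ℝ) : ℕ → Measure ℕ
  | 0 => (afterService mu Y n (T - a)).map (fun m => m + 1)
  | i + 1 => (afterArrival mu Y T n a i).bind
      (fun m => (afterService mu Y m T).map (fun m' => m' + 1))

/-- The law of the number of customers at time `t` when the process starts in `(n, a)` and `i`
arrivals take place in `(0, t]`. -/
def numberAt (mu : ℝ) (Y : Measure ℕ) (T t : ℝ) (n : ℕ) (a : ℝ) : ℕ → Measure ℕ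
  | 0 => afterService mu Y n t
  | i + 1 => (afterArrival mu Y T n a i).bind
      (fun m => afterService mu Y m (a + t - (i + 1) * T))

/-- The transition function of the Markov process (number present, time since the last arrival)
over a time `t`: the number of arrivals in `(0, t]` is `⌊(a + t) / T⌋`. -/
def deterministicTransition (mu : ℝ) (Y : Measure ℕ) (T t : ℝ) (s : ℕ × ℝ) : Measure (ℕ × ℝ) :=
  (numberAt mu Y T t s.1 s.2 ⌊(s.2 + t) / T⌋₊).map
    (fun m => (m, s.2 + t - ⌊(s.2 + t) / T⌋₊ * T))

/-- `P` is a stationary distribution of the queue with inter-arrival times equal to `T`. -/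
def IsDeterministicStationary (mu : ℝ) (Y : Measure ℕ) (T : ℝ) (P : Measure (ℕ × ℝ)) : Prop :=
  IsProbabilityMeasure P ∧ (∀ᵐ s ∂P, s.2 ∈ Set.Ico 0 T) ∧
    ∀ t : ℝ, 0 ≤ t → ∀ B : Set (ℕ × ℝ), MeasurableSet B →
      ∫⁻ s, deterministicTransition mu Y T t s B ∂P = P B

/-! ### Performance measures -/

/-- The law of the number of customers in the system, from the law of the full state. -/
def numberLaw {β : Type*} [MeasurableSpace β] (P : Measure (ℕ × β)) : Measure ℕ := P.map Prod.fst

/-- The mean number of customers in the system. -/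
def meanNumber (p : Measure ℕ) : ℝ := ∫ n, (n : ℝ) ∂p

/-- The variance of the number of customers in the system. -/
def varNumber (p : Measure ℕ) : ℝ := variance (fun n : ℕ => (n : ℝ)) p

/-- The stochastic order `p ⪯_st q`. -/
def StochLE (p q : Measure ℕ) : Prop := ∀ M : ℕ, p (Set.Ici M) ≤ q (Set.Ici M)

/-- `α` is a stationary law of the number of customers found by an arriving customer, when the
inter-arrival times are i.i.d. with law `A`: it is invariant for the Markov chain that leads from
`n` to the number left over from `n + 1` customers after an inter-arrival time. -/
def IsArrivalStationary (mu : ℝ) (Y : Measure ℕ) (A : Measure ℝ) (α : Measure ℕ) : Prop :=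
  IsProbabilityMeasure α ∧
    ∀ m, α {m} = ∑' n, α {n} * ∫⁻ a, afterService mu Y (n + 1) a {m} ∂A

/-- The expected sojourn time `∫₀^∞ ℙ(sojourn time > t) dt` of a customer who finds `n` customers
and who is served in order of arrival. This customer is still present after a time `t` exactly if
the `n + 1` customers present upon arrival have not all left. -/
def meanSojournGiven (mu : ℝ) (Y : Measure ℕ) (n : ℕ) : ℝ≥0∞ :=
  ∫⁻ t in Set.Ioi (0 : ℝ), afterService mu Y (n + 1) t (Set.Ioi 0)

/-- The expected sojourn time of a customer who finds a number of customers with law `α`. -/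
def meanSojourn (mu : ℝ) (Y : Measure ℕ) (α : Measure ℕ) : ℝ≥0∞ :=
  ∫⁻ n, meanSojournGiven mu Y n ∂α

end BatchQueue

end

/-!
Let `γ(z) = μ (1 - 𝔼[z ^ Y])`, the exponent for which a geometric number of customers with ratio
`z` is thinned by the factor `exp (-γ(z) t)` when it is served for a time `t`. For inter-arrival
times `A`, the geometric law with ratio `z` is therefore stationary for the queue found by arriving
customers as soon as `𝔼[exp (-γ(z) A)] = z`, and in continuous time all stationary laws have
geometric tails with the same ratio `z`. The mean number in the system is `λ* / γ(z)` and the mean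
sojourn time is `1 / γ(z)`, so everything is a function of `z` alone. Since
`(1 + x / k) ^ k` increases to `exp x`, the Laplace transforms of the Erlang laws with mean `1 / λ*`
decrease to that of the constant `1 / λ*`, and hence so do the roots `z`. It remains to see that the
mean, the variance and the sojourn time increase continuously with `z`; for the variance this uses
that `γ(z) / (1 - z)` is monotone, by convexity of `z ↦ 𝔼[z ^ Y]`.
-/

noncomputable section

namespace BatchQueue

/-! ### Invariant measures of Markov kernels -/

section Invariant

variable {S : Type*} [MeasurableSpace S] {κ : Kernel S S} {p q : Measure S}

theorem comp_mono (κ : Kernel S S) (h : p ≤ q) : κ ∘ₘ p ≤ κ ∘ₘ q := by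
  refine Measure.le_iff.2 fun B hB => ?_
  rw [Measure.bind_apply hB κ.aemeasurable, Measure.bind_apply hB κ.aemeasurable]
  exact lintegral_mono' h le_rfl

theorem invariant_sub [IsMarkovKernel κ] [IsFiniteMeasure p] [IsFiniteMeasure q]
    (hp : κ.Invariant p) (hq : κ.Invariant q) : κ.Invariant (p - q) := by
  have hle : p - q ≤ κ ∘ₘ (p - q) := by
    rw [Measure.sub_le_iff_le_add]
    calc p = κ ∘ₘ p := hp.symm
      _ ≤ κ ∘ₘ (p - q + q) := comp_mono κ (Measure.sub_le_iff_le_add.1 le_rfl)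
      _ = κ ∘ₘ (p - q) + q := by rw [Measure.comp_add, hq.def]
  exact (Measure.eq_of_le_of_measure_univ_eq hle Measure.comp_apply_univ.symm).symm

variable [Countable S] [MeasurableSingletonClass S]

theorem bind_apply_singleton_eq_tsum {R : Type*} [MeasurableSpace R] [MeasurableSingletonClass R]
    (p : Measure S) (f : S → Measure R) (r : R) : p.bind f {r} = ∑' s, p {s} * f s {r} := by
  rw [Measure.bind_apply (measurableSet_singleton r) Measurable.of_discrete.aemeasurable,
    lintegral_countable']
  simp_rw [mul_comm]

theorem iterate_singleton_ne_zero_of_invariant {f : S → S} (hf : ∀ s, κ s {f s} ≠ 0)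
    (hp : κ.Invariant p) {s : S} (hs : p {s} ≠ 0) (i : ℕ) : p {f^[i] s} ≠ 0 := by
  induction i with
  | zero => exact hs
  | succ i ih =>
    rw [Function.iterate_succ_apply', ← hp.def, bind_apply_singleton_eq_tsum]
    exact fun h => mul_ne_zero ih (hf _) (ENNReal.tsum_eq_zero.1 h (f^[i] s))

theorem invariant_eq_zero_or_of_mutuallySingular {f : S → S} (hf : ∀ s, κ s {f s} ≠ 0)
    (hmeet : ∀ s t, ∃ i j, f^[i] s = f^[j] t) (hp : κ.Invariant p) (hq : κ.Invariant q)
    (hpq : p ⟂ₘ q) : p = 0 ∨ q = 0 := by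
  by_contra! ⟨hp0, hq0⟩
  have exists_atom {r : Measure S} (hr : r ≠ 0) : ∃ s, r {s} ≠ 0 := by
    by_contra! h
    exact hr (Measure.ext_of_singleton h)
  obtain ⟨s, hs⟩ := exists_atom hp0
  obtain ⟨t, ht⟩ := exists_atom hq0
  obtain ⟨i, j, hij⟩ := hmeet s t
  obtain ⟨B, -, hpB, hqB⟩ := hpq
  by_cases hB : f^[i] s ∈ B
  · exact iterate_singleton_ne_zero_of_invariant hf hp hs i
      (measure_mono_null (Set.singleton_subset_iff.2 hB) hpB)
  · exact iterate_singleton_ne_zero_of_invariant hf hq ht j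
      (measure_mono_null (Set.singleton_subset_iff.2 (hij ▸ hB)) hqB)

-- The parts `p - q` and `q - p` are invariant and mutually singular, so that one of them vanishes.
theorem invariant_unique [IsMarkovKernel κ] {f : S → S} (hf : ∀ s, κ s {f s} ≠ 0)
    (hmeet : ∀ s t, ∃ i j, f^[i] s = f^[j] t) [IsProbabilityMeasure p] [IsProbabilityMeasure q]
    (hp : κ.Invariant p) (hq : κ.Invariant q) : p = q := by
  rcases invariant_eq_zero_or_of_mutuallySingular hf hmeet (invariant_sub hp hq)
    (invariant_sub hq hp) Measure.mutually_singular_measure_sub with h | h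
  · refine Measure.eq_of_le_of_isProbabilityMeasure ?_
    simpa [h] using Measure.sub_le_iff_le_add.1 h.le
  · refine (Measure.eq_of_le_of_isProbabilityMeasure ?_).symm
    simpa [h] using Measure.sub_le_iff_le_add.1 h.le

end Invariant

/-! ### Laws with geometric tails -/

/-- The law `p` is a modified geometric distribution: the weights of `{1, 2, …}`, `{2, 3, …}`, …
are `q, q * z, q * z ^ 2, …`. All stationary laws of the queues have this form. -/
structure HasGeomTail (z q : ℝ) (p : Measure ℕ) : Prop where
  isProbabilityMeasure : IsProbabilityMeasure p
  real_Ici : ∀ M : ℕ, p.real (Set.Ici (M + 1)) = q * z ^ M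

theorem lintegral_ofReal_sum_range (p : Measure ℕ) {c : ℕ → ℝ} (hc : ∀ M, 0 ≤ c M) :
    ∫⁻ n, ENNReal.ofReal (∑ M ∈ Finset.range n, c M) ∂p
      = ∑' M, ENNReal.ofReal (c M) * p (Set.Ici (M + 1)) := by
  have sum_range_eq (n : ℕ) : ENNReal.ofReal (∑ M ∈ Finset.range n, c M)
      = ∑' M, (Set.Ici (M + 1)).indicator (fun _ => ENNReal.ofReal (c M)) n := by
    rw [ENNReal.ofReal_sum_of_nonneg fun M _ => hc M, tsum_eq_sum (s := Finset.range n)]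
    · exact Finset.sum_congr rfl fun M hM =>
        (Set.indicator_of_mem (Set.mem_Ici.2 (Finset.mem_range.1 hM))
          fun _ => ENNReal.ofReal (c M)).symm
    · exact fun M hM => Set.indicator_of_notMem (fun h => hM (Finset.mem_range.2 h)) _
  simp_rw [sum_range_eq]
  rw [lintegral_tsum fun M => Measurable.of_discrete.aemeasurable]
  simp_rw [lintegral_indicator_const measurableSet_Ici]

theorem ext_of_Ici {p q : Measure ℕ} [IsProbabilityMeasure p] [IsProbabilityMeasure q]
    (h : ∀ M, p (Set.Ici (M + 1)) = q (Set.Ici (M + 1))) : p = q := by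
  refine Measure.ext_of_Ici p q fun M => ?_
  cases M with
  | zero => simp
  | succ M => exact h M

theorem bind_map_sub_apply_Ici (p ν : Measure ℕ) [SFinite p] [SFinite ν] (M : ℕ) :
    (p.bind fun n => ν.map fun s => n - s) (Set.Ici (M + 1))
      = ∫⁻ s, p (Set.Ici (M + s + 1)) ∂ν := by
  have map_sub_Ici (n : ℕ) : (ν.map fun s => n - s) (Set.Ici (M + 1))
      = ∫⁻ s, (Set.Ici (M + s + 1)).indicator 1 n ∂ν := by
    rw [Measure.map_apply Measurable.of_discrete measurableSet_Ici,
      ← lintegral_indicator_one (MeasurableSet.of_discrete)]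
    refine lintegral_congr fun s => ?_
    have : M + 1 ≤ n - s ↔ M + s + 1 ≤ n := by omega
    simp [Set.indicator, this]
  rw [Measure.bind_apply measurableSet_Ici Measurable.of_discrete.aemeasurable]
  simp_rw [map_sub_Ici]
  rw [lintegral_lintegral_swap Measurable.of_discrete.aemeasurable]
  simp_rw [lintegral_indicator_one measurableSet_Ici]

theorem isProbabilityMeasure_bind {β γ : Type*} [MeasurableSpace β] [MeasurableSpace γ]
    {m : Measure β} [IsProbabilityMeasure m] {f : β → Measure γ} (hf : Measurable f)
    (h : ∀ᵐ a ∂m, IsProbabilityMeasure (f a)) : IsProbabilityMeasure (m.bind f) := by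
  refine ⟨?_⟩
  rw [Measure.bind_apply MeasurableSet.univ hf.aemeasurable,
    lintegral_congr_ae (h.mono fun a ha => ha.measure_univ)]
  simp

theorem sum_range_two_mul_add_one (n : ℕ) :
    ∑ M ∈ Finset.range n, (2 * (M : ℝ) + 1) = (n : ℝ) ^ 2 := by
  induction n with
  | zero => simp
  | succ n ih => rw [Finset.sum_range_succ, ih]; push_cast; ring

theorem hasSum_two_mul_add_one_mul_pow {z : ℝ} (hz : 0 ≤ z) (hz1 : z < 1) :
    HasSum (fun M : ℕ => (2 * (M : ℝ) + 1) * z ^ M) ((1 + z) / (1 - z) ^ 2) := by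
  have hne : 1 - z ≠ 0 := by linarith
  have linear : HasSum (fun M : ℕ => (M : ℝ) * z ^ M) (z / (1 - z) ^ 2) :=
    hasSum_coe_mul_geometric_of_norm_lt_one (by rwa [Real.norm_of_nonneg hz])
  have value : (1 + z) / (1 - z) ^ 2 = 2 * (z / (1 - z) ^ 2) + (1 - z)⁻¹ := by field_simp; ring
  rw [value]
  exact ((linear.mul_left 2).add (hasSum_geometric_of_lt_one hz hz1)).congr_fun fun M => by ring

namespace HasGeomTail

variable {z z' q q' : ℝ} {p p' : Measure ℕ}

theorem of_measure_Ici [hp : IsProbabilityMeasure p] (hz : 0 ≤ z) (hq : 0 ≤ q)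
    (h : ∀ M : ℕ, p (Set.Ici (M + 1)) = ENNReal.ofReal (q * z ^ M)) : HasGeomTail z q p :=
  ⟨hp, fun M => by rw [measureReal_def, h, ENNReal.toReal_ofReal (by positivity)]⟩

theorem measure_Ici (h : HasGeomTail z q p) (M : ℕ) :
    p (Set.Ici (M + 1)) = ENNReal.ofReal (q * z ^ M) := by
  have := h.isProbabilityMeasure
  rw [← h.real_Ici, ofReal_measureReal]

theorem real_Ici_one (h : HasGeomTail z q p) : p.real (Set.Ici 1) = q := by
  simpa using h.real_Ici 0

theorem nonneg (h : HasGeomTail z q p) : 0 ≤ q := h.real_Ici_one ▸ measureReal_nonneg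

theorem le_one (h : HasGeomTail z q p) : q ≤ 1 := by
  have := h.isProbabilityMeasure
  exact h.real_Ici_one ▸ measureReal_le_one

theorem unique (h : HasGeomTail z q p) (h' : HasGeomTail z q p') : p = p' := by
  have := h.isProbabilityMeasure
  have := h'.isProbabilityMeasure
  exact ext_of_Ici fun M => by rw [h.measure_Ici, h'.measure_Ici]

theorem stochLE (h : HasGeomTail z q p) (h' : HasGeomTail z' q p') (hz : 0 ≤ z) (hzz' : z ≤ z') :
    StochLE p p' := by
  have := h.isProbabilityMeasure
  have := h'.isProbabilityMeasure
  rintro (_ | M)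
  · simp
  · rw [h.measure_Ici, h'.measure_Ici]
    have := h.nonneg
    gcongr

theorem map_add_one (h : HasGeomTail z z p) : HasGeomTail z 1 (p.map (· + 1)) := by
  have := h.isProbabilityMeasure
  refine ⟨Measure.isProbabilityMeasure_map (by fun_prop), fun M => ?_⟩
  rw [map_measureReal_apply (by fun_prop) measurableSet_Ici,
    show (· + 1) ⁻¹' Set.Ici (M + 1) = Set.Ici M by ext; simp]
  cases M with
  | zero => simp
  | succ M => rw [h.real_Ici]; ring

theorem convexComb (h : HasGeomTail z q p) (h' : HasGeomTail z q' p') {a b : ℝ} (ha : 0 ≤ a)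
    (hb : 0 ≤ b) (hab : a + b = 1) :
    HasGeomTail z (a * q + b * q') (ENNReal.ofReal a • p + ENNReal.ofReal b • p') := by
  have := h.isProbabilityMeasure
  have := h'.isProbabilityMeasure
  refine ⟨⟨?_⟩, fun M => ?_⟩
  · simp [← ENNReal.ofReal_add ha hb, hab]
  · have := Measure.smul_finite p (c := ENNReal.ofReal a) ENNReal.ofReal_ne_top
    have := Measure.smul_finite p' (c := ENNReal.ofReal b) ENNReal.ofReal_ne_top
    rw [measureReal_add_apply, measureReal_ennreal_smul_apply, measureReal_ennreal_smul_apply,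
      h.real_Ici, h'.real_Ici, ENNReal.toReal_ofReal ha, ENNReal.toReal_ofReal hb]
    ring

theorem bind_map_sub (h : HasGeomTail z q p) (hz : 0 ≤ z) (ν : Measure ℕ) [IsProbabilityMeasure ν]
    {c : ℝ} (hc : 0 ≤ c) (hν : ∫⁻ s, ENNReal.ofReal (z ^ s) ∂ν = ENNReal.ofReal c) :
    HasGeomTail z (q * c) (p.bind fun n => ν.map fun s => n - s) := by
  have := h.isProbabilityMeasure
  have : IsProbabilityMeasure (p.bind fun n => ν.map fun s => n - s) :=
    isProbabilityMeasure_bind Measurable.of_discrete (ae_of_all _ fun n =>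
      Measure.isProbabilityMeasure_map Measurable.of_discrete.aemeasurable)
  refine of_measure_Ici hz (mul_nonneg h.nonneg hc) fun M => ?_
  have tail (s : ℕ) : p (Set.Ici (M + s + 1))
      = ENNReal.ofReal (q * z ^ M) * ENNReal.ofReal (z ^ s) := by
    rw [h.measure_Ici, ← ENNReal.ofReal_mul (mul_nonneg h.nonneg (by positivity)), pow_add,
      mul_assoc]
  rw [bind_map_sub_apply_Ici]
  simp_rw [tail]
  rw [lintegral_const_mul _ Measurable.of_discrete, hν, ← ENNReal.ofReal_mul' hc]
  ring_nf

theorem bind {β : Type*} [MeasurableSpace β] {m : Measure β} [IsProbabilityMeasure m]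
    {f : β → Measure ℕ} (hf : Measurable f) {q : β → ℝ} (hq : AEStronglyMeasurable q m)
    (hz : 0 ≤ z) (h : ∀ᵐ a ∂m, HasGeomTail z (q a) (f a)) :
    HasGeomTail z (∫ a, q a ∂m) (m.bind f) := by
  have := isProbabilityMeasure_bind hf (h.mono fun a ha => ha.isProbabilityMeasure)
  have q_nonneg : 0 ≤ᵐ[m] q := h.mono fun a ha => ha.nonneg
  refine of_measure_Ici hz (integral_nonneg_of_ae q_nonneg) fun M => ?_
  have q_integrable : Integrable q m := .of_bound hq 1 <| h.mono fun a ha => by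
    rw [Real.norm_of_nonneg ha.nonneg]
    exact ha.le_one
  rw [Measure.bind_apply measurableSet_Ici hf.aemeasurable,
    lintegral_congr_ae (h.mono fun a ha => ha.measure_Ici M), ← integral_mul_const,
    ofReal_integral_eq_lintegral_ofReal (q_integrable.mul_const _)
      (q_nonneg.mono fun a ha => mul_nonneg ha (by positivity))]

theorem dirac_zero (z : ℝ) : HasGeomTail z 0 (Measure.dirac 0) :=
  ⟨inferInstance, fun M => by simp [measureReal_def]⟩

theorem exists_self (hz : 0 ≤ z) (hz1 : z < 1) : ∃ p, HasGeomTail z z p := by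
  obtain ⟨u, hu0, hu⟩ : ∃ u : unitInterval, u ≠ 0 ∧ (u : ℝ) = 1 - z :=
    ⟨⟨1 - z, by linarith, by linarith⟩,
      fun h => (sub_pos.2 hz1).ne' (congrArg Subtype.val h), rfl⟩
  refine ⟨geometricMeasure u, inferInstance, fun M => ?_⟩
  rw [show Set.Ici (M + 1) = ((Finset.range (M + 1) : Finset ℕ) : Set ℕ)ᶜ by ext; simp,
    probReal_compl_eq_one_sub (Finset.measurableSet _), ← sum_measureReal_singleton]
  have weight (n : ℕ) : (geometricMeasure u).real {n} = z ^ n * (1 - z) := by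
    rw [measureReal_def, geometricMeasure_singleton hu0, hu, sub_sub_cancel,
      ENNReal.toReal_ofReal (mul_nonneg (by positivity) (by linarith))]
  simp_rw [weight]
  rw [← Finset.sum_mul, geom_sum_mul_neg]
  ring

theorem exists_of_le_one (hz : 0 ≤ z) (hz1 : z < 1) (hq : 0 ≤ q) (hq1 : q ≤ 1) :
    ∃ p, HasGeomTail z q p := by
  obtain ⟨p, hp⟩ := exists_self hz hz1
  have := hp.map_add_one.convexComb (dirac_zero z) hq (sub_nonneg.2 hq1) (add_sub_cancel q 1)
  exact ⟨_, by simpa using this⟩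

theorem lintegral_sum_range (h : HasGeomTail z q p) (hz : 0 ≤ z) {c : ℕ → ℝ} (hc : ∀ M, 0 ≤ c M)
    {s : ℝ} (hs : HasSum (fun M => c M * z ^ M) s) :
    ∫⁻ n, ENNReal.ofReal (∑ M ∈ Finset.range n, c M) ∂p = ENNReal.ofReal (q * s) := by
  have hq := h.nonneg
  rw [lintegral_ofReal_sum_range p hc, ← (hs.mul_left q).tsum_eq, ENNReal.ofReal_tsum_of_nonneg
    (fun M => by have := hc M; positivity) (hs.mul_left q).summable]
  refine tsum_congr fun M => ?_
  rw [h.measure_Ici, ← ENNReal.ofReal_mul (hc M)]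
  ring_nf

theorem integrable_sum_range (h : HasGeomTail z q p) (hz : 0 ≤ z) {c : ℕ → ℝ} (hc : ∀ M, 0 ≤ c M)
    {s : ℝ} (hs : HasSum (fun M => c M * z ^ M) s) :
    Integrable (fun n => ∑ M ∈ Finset.range n, c M) p := by
  refine ⟨Measurable.of_discrete.aestronglyMeasurable, ?_⟩
  rw [hasFiniteIntegral_iff_ofReal (ae_of_all _ fun n => Finset.sum_nonneg fun M _ => hc M),
    h.lintegral_sum_range hz hc hs]
  exact ENNReal.ofReal_lt_top

theorem integral_sum_range (h : HasGeomTail z q p) (hz : 0 ≤ z) {c : ℕ → ℝ} (hc : ∀ M, 0 ≤ c M)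
    {s : ℝ} (hs : HasSum (fun M => c M * z ^ M) s) :
    ∫ n, ∑ M ∈ Finset.range n, c M ∂p = q * s := by
  rw [integral_eq_lintegral_of_nonneg_ae (ae_of_all _ fun n => Finset.sum_nonneg fun M _ => hc M)
    Measurable.of_discrete.aestronglyMeasurable, h.lintegral_sum_range hz hc hs,
    ENNReal.toReal_ofReal]
  exact mul_nonneg h.nonneg (hs.nonneg fun M => mul_nonneg (hc M) (by positivity))

theorem meanNumber_eq (h : HasGeomTail z q p) (hz : 0 ≤ z) (hz1 : z < 1) :
    meanNumber p = q / (1 - z) := by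
  have geom : HasSum (fun M => (fun _ => (1 : ℝ)) M * z ^ M) (1 - z)⁻¹ := by
    simpa using hasSum_geometric_of_lt_one hz hz1
  simpa [meanNumber, div_eq_mul_inv] using h.integral_sum_range hz (fun _ => zero_le_one) geom

theorem memLp_two (h : HasGeomTail z q p) (hz : 0 ≤ z) (hz1 : z < 1) :
    MemLp (fun n : ℕ => (n : ℝ)) 2 p := by
  rw [memLp_two_iff_integrable_sq Measurable.of_discrete.aestronglyMeasurable]
  simp_rw [← sum_range_two_mul_add_one]
  exact h.integrable_sum_range hz (fun M => by positivity) (hasSum_two_mul_add_one_mul_pow hz hz1)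

theorem varNumber_eq (h : HasGeomTail z q p) (hz : 0 ≤ z) (hz1 : z < 1) :
    varNumber p = q * ((1 + z) / (1 - z) ^ 2) - (q / (1 - z)) ^ 2 := by
  have := h.isProbabilityMeasure
  rw [varNumber, variance_eq_sub (h.memLp_two hz hz1), ← h.meanNumber_eq hz hz1, meanNumber]
  simp_rw [Pi.pow_apply, ← sum_range_two_mul_add_one]
  rw [h.integral_sum_range hz (fun M => by positivity) (hasSum_two_mul_add_one_mul_pow hz hz1)]

end HasGeomTail

/-! ### The probability generating function of a batch -/

section BatchPgf

variable {Y : Measure ℕ} {z : ℝ}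

/-- The probability generating function `z ↦ 𝔼 z ^ Y` of a batch, considered for `0 ≤ z ≤ 1`. -/
def batchPgf (Y : Measure ℕ) (z : ℝ) : ℝ := ∫ j, z ^ j ∂Y

theorem integrable_pow [IsFiniteMeasure Y] (hz : 0 ≤ z) (hz1 : z ≤ 1) :
    Integrable (fun j : ℕ => z ^ j) Y :=
  .of_bound Measurable.of_discrete.aestronglyMeasurable 1 <| ae_of_all _ fun j => by
    rw [Real.norm_of_nonneg (by positivity)]
    exact pow_le_one₀ hz hz1

theorem lintegral_ofReal_pow [IsFiniteMeasure Y] (hz : 0 ≤ z) (hz1 : z ≤ 1) :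
    ∫⁻ j, ENNReal.ofReal (z ^ j) ∂Y = ENNReal.ofReal (batchPgf Y z) :=
  (ofReal_integral_eq_lintegral_ofReal (integrable_pow hz hz1)
    (ae_of_all _ fun j => by positivity)).symm

theorem batchPgf_nonneg (hz : 0 ≤ z) : 0 ≤ batchPgf Y z :=
  integral_nonneg fun j => by positivity

theorem batchPgf_one [IsProbabilityMeasure Y] : batchPgf Y 1 = 1 := by simp [batchPgf]

theorem batchPgf_monotoneOn [IsFiniteMeasure Y] : MonotoneOn (batchPgf Y) (Set.Icc 0 1) :=
  fun _ hz _ hw hzw => integral_mono (integrable_pow hz.1 hz.2) (integrable_pow hw.1 hw.2)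
    fun j => pow_le_pow_left₀ hz.1 hzw j

theorem batchPgf_le_one [IsProbabilityMeasure Y] (hz : 0 ≤ z) (hz1 : z ≤ 1) : batchPgf Y z ≤ 1 :=
  batchPgf_one (Y := Y) ▸ batchPgf_monotoneOn ⟨hz, hz1⟩ ⟨zero_le_one, le_rfl⟩ hz1

theorem continuousOn_batchPgf [IsFiniteMeasure Y] : ContinuousOn (batchPgf Y) (Set.Icc 0 1) :=
  continuousOn_of_dominated (bound := fun _ => 1)
    (fun _ _ => Measurable.of_discrete.aestronglyMeasurable)
    (fun z hz => ae_of_all _ fun j => by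
      rw [Real.norm_of_nonneg (pow_nonneg hz.1 j)]
      exact pow_le_one₀ hz.1 hz.2)
    (integrable_const 1) (ae_of_all _ fun j => (continuous_pow j).continuousOn)

theorem convexOn_batchPgf [IsFiniteMeasure Y] : ConvexOn ℝ (Set.Icc 0 1) (batchPgf Y) := by
  refine ⟨convex_Icc 0 1, fun z hz w hw a b ha hb hab => ?_⟩
  have hzw := convex_Icc (0 : ℝ) 1 hz hw ha hb hab
  have hz_int := (integrable_pow (Y := Y) hz.1 hz.2).const_mul a
  have hw_int := (integrable_pow (Y := Y) hw.1 hw.2).const_mul b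
  calc batchPgf Y (a • z + b • w) ≤ ∫ j, (a * z ^ j + b * w ^ j) ∂Y :=
        integral_mono (integrable_pow hzw.1 hzw.2) (hz_int.add hw_int)
          fun j => (convexOn_pow j).2 hz.1 hw.1 ha hb hab
    _ = a • batchPgf Y z + b • batchPgf Y w := by
        rw [integral_add hz_int hw_int, integral_const_mul, integral_const_mul]
        rfl

end BatchPgf

/-! ### The service process -/

section Service

variable {mu : ℝ} {Y : Measure ℕ} {z q t : ℝ}

/-- The exponential decay rate `γ` of `𝔼 z ^ S_t = exp (-γ t)`, where `S_t` is the total size of the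
batches completed in a time interval of length `t` by a server that never stops. -/
def serviceExponent (mu : ℝ) (Y : Measure ℕ) (z : ℝ) : ℝ := mu * (1 - batchPgf Y z)

theorem continuousOn_serviceExponent [IsFiniteMeasure Y] :
    ContinuousOn (serviceExponent mu Y) (Set.Icc 0 1) :=
  continuousOn_const.mul (continuousOn_const.sub continuousOn_batchPgf)

theorem antitoneOn_serviceExponent [IsFiniteMeasure Y] (hmu : 0 ≤ mu) :
    AntitoneOn (serviceExponent mu Y) (Set.Icc 0 1) := fun _ hz _ hw hzw =>
  mul_le_mul_of_nonneg_left (sub_le_sub_left (batchPgf_monotoneOn hz hw hzw) 1) hmu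

theorem serviceExponent_nonneg [IsProbabilityMeasure Y] (hmu : 0 ≤ mu) (hz : 0 ≤ z) (hz1 : z ≤ 1) :
    0 ≤ serviceExponent mu Y z :=
  mul_nonneg hmu (sub_nonneg.2 (batchPgf_le_one hz hz1))

-- The quotients are the secant slopes through `1` of the convex function `batchPgf Y`.
theorem serviceExponent_div_one_sub_le [IsProbabilityMeasure Y] {w : ℝ} (hmu : 0 ≤ mu)
    (hz : 0 ≤ z) (hzw : z ≤ w) (hw : w < 1) :
    serviceExponent mu Y z / (1 - z) ≤ serviceExponent mu Y w / (1 - w) := by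
  have secant := convexOn_batchPgf (Y := Y).secant_mono ⟨zero_le_one, le_rfl⟩
    ⟨hz, hzw.trans hw.le⟩ ⟨hz.trans hzw, hw.le⟩ (hzw.trans_lt hw).ne hw.ne hzw
  have flip (x : ℝ) : (batchPgf Y x - 1) / (x - 1) = (1 - batchPgf Y x) / (1 - x) := by
    rw [← neg_div_neg_eq, neg_sub, neg_sub]
  rw [batchPgf_one, flip, flip] at secant
  simpa only [serviceExponent, mul_div_assoc] using mul_le_mul_of_nonneg_left secant hmu

theorem ae_eq_one_of_apply_singleton [IsProbabilityMeasure Y] (hY : Y {1} = 1) :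
    ∀ᵐ j ∂Y, j = 1 := by
  rw [ae_iff, ← Set.compl_ofPred, prob_compl_eq_zero_iff .of_discrete]
  simpa using hY

theorem serviceExponent_of_singleton_one [IsProbabilityMeasure Y] (hY : Y {1} = 1) (z : ℝ) :
    serviceExponent mu Y z = mu * (1 - z) := by
  have hY' : ∀ᵐ j ∂Y, z ^ j = z := by
    filter_upwards [ae_eq_one_of_apply_singleton hY] with j hj
    rw [hj, pow_one]
  rw [serviceExponent, batchPgf, integral_congr_ae hY', integral_const, probReal_univ, one_smul]

instance isProbabilityMeasure_batchSum [IsProbabilityMeasure Y] (j : ℕ) :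
    IsProbabilityMeasure (batchSum Y j) := by
  induction j with
  | zero => rw [batchSum]; infer_instance
  | succ j ih => rw [batchSum]; infer_instance

instance isProbabilityMeasure_servedLaw [IsProbabilityMeasure Y] :
    IsProbabilityMeasure (servedLaw mu Y t) :=
  isProbabilityMeasure_bind Measurable.of_discrete (ae_of_all _ fun _ => inferInstance)

instance isProbabilityMeasure_afterService [IsProbabilityMeasure Y] (n : ℕ) :
    IsProbabilityMeasure (afterService mu Y n t) :=
  Measure.isProbabilityMeasure_map Measurable.of_discrete.aemeasurable

theorem measurable_poissonMeasure : Measurable poissonMeasure := by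
  refine Measure.measurable_of_measurable_coe _ fun B hB => ?_
  simp_rw [poissonMeasure, Measure.sum_apply _ hB, Measure.smul_apply, smul_eq_mul]
  exact Measurable.tsum fun n => by fun_prop

theorem measurable_afterService (n : ℕ) : Measurable (afterService mu Y n) :=
  (Measure.measurable_map _ Measurable.of_discrete).comp <|
    (Measure.measurable_bind' Measurable.of_discrete).comp <|
      measurable_poissonMeasure.comp (by fun_prop)

theorem measurable_afterService_apply (n : ℕ) (B : Set ℕ) :
    Measurable fun t => afterService mu Y n t B :=
  (Measure.measurable_coe .of_discrete).comp (measurable_afterService n)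

theorem lintegral_ofReal_pow_batchSum [IsProbabilityMeasure Y] (hz : 0 ≤ z) (hz1 : z ≤ 1) (j : ℕ) :
    ∫⁻ s, ENNReal.ofReal (z ^ s) ∂(batchSum Y j) = ENNReal.ofReal (batchPgf Y z ^ j) := by
  have hG := batchPgf_nonneg (Y := Y) hz
  induction j with
  | zero => simp [batchSum]
  | succ j ih =>
    rw [batchSum, Measure.lintegral_conv Measurable.of_discrete]
    simp_rw [pow_add, ENNReal.ofReal_mul (pow_nonneg hz _)]
    simp_rw [lintegral_const_mul _ (Measurable.of_discrete (f := fun _ : ℕ => ENNReal.ofReal _))]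
    rw [lintegral_mul_const _ Measurable.of_discrete, ih, lintegral_ofReal_pow hz hz1, pow_one,
      ← ENNReal.ofReal_mul (by positivity)]

theorem lintegral_ofReal_pow_poissonMeasure (r : ℝ≥0) (hz : 0 ≤ z) :
    ∫⁻ j, ENNReal.ofReal (z ^ j) ∂(poissonMeasure r)
      = ENNReal.ofReal (Real.exp (-(r * (1 - z)))) := by
  have expansion : HasSum (fun n : ℕ => Real.exp (-r) * ((r * z) ^ n / n.factorial))
      (Real.exp (-(r * (1 - z)))) := by
    have := (NormedSpace.expSeries_div_hasSum_exp ((r : ℝ) * z)).mul_left (Real.exp (-r))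
    rw [← Real.exp_eq_exp_ℝ, ← Real.exp_add] at this
    rwa [show -(r * (1 - z)) = -(r : ℝ) + r * z by ring]
  rw [lintegral_countable', ← expansion.tsum_eq,
    ENNReal.ofReal_tsum_of_nonneg (fun n => by positivity) expansion.summable]
  refine tsum_congr fun n => ?_
  rw [poissonMeasure_singleton, ← ENNReal.ofReal_mul (by positivity)]
  congr 1
  rw [mul_pow]
  ring

theorem lintegral_ofReal_pow_servedLaw [IsProbabilityMeasure Y] (hmu : 0 ≤ mu) (hz : 0 ≤ z)
    (hz1 : z ≤ 1) (ht : 0 ≤ t) :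
    ∫⁻ s, ENNReal.ofReal (z ^ s) ∂(servedLaw mu Y t)
      = ENNReal.ofReal (Real.exp (-(serviceExponent mu Y z * t))) := by
  rw [servedLaw, Measure.lintegral_bind Measurable.of_discrete.aemeasurable
    Measurable.of_discrete.aemeasurable]
  simp_rw [lintegral_ofReal_pow_batchSum hz hz1]
  rw [lintegral_ofReal_pow_poissonMeasure _ (batchPgf_nonneg hz),
    Real.coe_toNNReal _ (by positivity), serviceExponent]
  ring_nf

theorem HasGeomTail.bind_afterService [IsProbabilityMeasure Y] {p : Measure ℕ}
    (h : HasGeomTail z q p) (hmu : 0 ≤ mu) (hz : 0 ≤ z) (hz1 : z ≤ 1) (ht : 0 ≤ t) :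
    HasGeomTail z (q * Real.exp (-(serviceExponent mu Y z * t)))
      (p.bind fun n => afterService mu Y n t) :=
  h.bind_map_sub hz _ (Real.exp_pos _).le (lintegral_ofReal_pow_servedLaw hmu hz hz1 ht)

theorem servedLaw_singleton_zero_ne_zero : servedLaw mu Y t {0} ≠ 0 := by
  rw [servedLaw, bind_apply_singleton_eq_tsum]
  refine fun h => mul_ne_zero ?_ ?_ (ENNReal.tsum_eq_zero.1 h 0)
  · simp [poissonMeasure_singleton, Real.exp_pos]
  · simp [batchSum]

theorem afterService_singleton_self_ne_zero (n : ℕ) : afterService mu Y n t {n} ≠ 0 := by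
  rw [afterService, Measure.map_apply Measurable.of_discrete (measurableSet_singleton n)]
  exact fun h => servedLaw_singleton_zero_ne_zero (measure_mono_null (by simp) h)

end Service

/-! ### The embedded chain at arrivals -/

section EmbeddedChain

variable {mu : ℝ} {Y : Measure ℕ} {A B : Measure ℝ} {α β : Measure ℕ} {z w : ℝ}

theorem measurable_bind_of_countable {R S T : Type*} [MeasurableSpace R] [MeasurableSpace S]
    [MeasurableSpace T] [Countable S] [MeasurableSingletonClass S] {p : R → Measure S}
    (hp : Measurable p) {f : S → R → Measure T} (hf : ∀ s, Measurable (f s)) :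
    Measurable fun r => (p r).bind fun s => f s r := by
  refine Measure.measurable_of_measurable_coe _ fun C hC => ?_
  simp_rw [Measure.bind_apply hC Measurable.of_discrete.aemeasurable, lintegral_countable']
  exact Measurable.tsum fun s => ((Measure.measurable_coe hC).comp (hf s)).mul
    ((Measure.measurable_coe (measurableSet_singleton s)).comp hp)

theorem bind_bind_comm_of_countable {R S T : Type*} [MeasurableSpace R] [MeasurableSpace S]
    [MeasurableSpace T] [Countable S] [MeasurableSingletonClass S] (p : Measure S) [SFinite p]
    (m : Measure R) [SFinite m] {f : S → R → Measure T} (hf : ∀ s, Measurable (f s)) :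
    (p.bind fun s => m.bind (f s)) = m.bind fun r => p.bind fun s => f s r := by
  ext C hC
  rw [Measure.bind_apply hC Measurable.of_discrete.aemeasurable,
    Measure.bind_apply hC (measurable_bind_of_countable measurable_const hf).aemeasurable]
  simp_rw [Measure.bind_apply hC (hf _).aemeasurable,
    Measure.bind_apply hC Measurable.of_discrete.aemeasurable]
  exact lintegral_lintegral_swap (measurable_from_prod_countable_right fun s =>
    (Measure.measurable_coe hC).comp (hf s)).aemeasurable

/-- The transition kernel of the Markov chain of the numbers of customers found by successive
arriving customers, for inter-arrival times with law `A`. -/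
def arrivalKernel (mu : ℝ) (Y : Measure ℕ) (A : Measure ℝ) : Kernel ℕ ℕ :=
  Kernel.ofFunOfCountable fun n => A.bind (afterService mu Y (n + 1))

instance [IsProbabilityMeasure Y] [IsProbabilityMeasure A] :
    IsMarkovKernel (arrivalKernel mu Y A) :=
  ⟨fun n => isProbabilityMeasure_bind (measurable_afterService (n + 1))
    (ae_of_all _ fun _ => inferInstance)⟩

theorem arrivalKernel_apply_singleton (n m : ℕ) :
    arrivalKernel mu Y A n {m} = ∫⁻ a, afterService mu Y (n + 1) a {m} ∂A :=
  Measure.bind_apply (measurableSet_singleton m) (measurable_afterService _).aemeasurable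

theorem isArrivalStationary_iff :
    IsArrivalStationary mu Y A α ↔ IsProbabilityMeasure α ∧ (arrivalKernel mu Y A).Invariant α := by
  refine and_congr_right fun _ => ?_
  rw [Kernel.Invariant, Measure.ext_iff_singleton]
  simp_rw [bind_apply_singleton_eq_tsum, arrivalKernel_apply_singleton, eq_comm (a := α {_})]

theorem arrivalKernel_apply_succ_ne_zero [NeZero A] (n : ℕ) :
    arrivalKernel mu Y A n {n + 1} ≠ 0 := by
  intro h
  rw [arrivalKernel_apply_singleton, lintegral_eq_zero_iff (measurable_afterService_apply _ _)] at h
  obtain ⟨a, ha⟩ := h.exists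
  exact afterService_singleton_self_ne_zero (n + 1) ha

theorem IsArrivalStationary.unique [IsProbabilityMeasure Y] [IsProbabilityMeasure A]
    (hα : IsArrivalStationary mu Y A α) (hβ : IsArrivalStationary mu Y A β) : α = β := by
  have := hα.1
  have := hβ.1
  refine invariant_unique arrivalKernel_apply_succ_ne_zero (fun s t => ⟨t, s, ?_⟩)
    (isArrivalStationary_iff.1 hα).2 (isArrivalStationary_iff.1 hβ).2
  simp [add_comm]

/-- `z` is a root in `(0, 1)` of the characteristic equation `𝔼 exp (-γ(z) A) = z` of the embedded
chain, where `γ` is `serviceExponent mu Y`. It is the decay rate of the tails of the stationary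
laws. -/
structure IsDecayRate (mu : ℝ) (Y : Measure ℕ) (A : Measure ℝ) (z : ℝ) : Prop where
  pos : 0 < z
  lt_one : z < 1
  mgf_eq : mgf id A (-serviceExponent mu Y z) = z

theorem IsDecayRate.serviceExponent_pos [IsProbabilityMeasure Y] [IsProbabilityMeasure A]
    (hz : IsDecayRate mu Y A z) (hmu : 0 ≤ mu) : 0 < serviceExponent mu Y z := by
  refine (serviceExponent_nonneg hmu hz.pos.le hz.lt_one.le).lt_of_ne fun h => hz.lt_one.ne ?_
  rw [← hz.mgf_eq, ← h, neg_zero, mgf_zero]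

theorem HasGeomTail.bind_arrivalKernel [IsProbabilityMeasure Y] [IsProbabilityMeasure A]
    (hα : HasGeomTail z z α) (hmu : 0 ≤ mu) (hz : 0 ≤ z) (hz1 : z ≤ 1) (hA : ∀ᵐ a ∂A, 0 ≤ a) :
    HasGeomTail z (mgf id A (-serviceExponent mu Y z)) (arrivalKernel mu Y A ∘ₘ α) := by
  have := hα.isProbabilityMeasure
  have comp_eq : arrivalKernel mu Y A ∘ₘ α
      = A.bind fun a => (α.map (· + 1)).bind fun n => afterService mu Y n a := by
    simp_rw [← Measure.bind_dirac_eq_map α (Measurable.of_discrete (f := (· + 1))),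
      Measure.bind_bind Measurable.of_discrete.aemeasurable Measurable.of_discrete.aemeasurable,
      Measure.dirac_bind Measurable.of_discrete]
    exact bind_bind_comm_of_countable α A fun n => measurable_afterService (n + 1)
  rw [comp_eq]
  refine bind (measurable_bind_of_countable measurable_const measurable_afterService)
    (by fun_prop) hz ?_
  filter_upwards [hA] with a ha
  simpa using hα.map_add_one.bind_afterService hmu hz hz1 ha

theorem IsDecayRate.isArrivalStationary [IsProbabilityMeasure Y] [IsProbabilityMeasure A]
    (hz : IsDecayRate mu Y A z) (hmu : 0 ≤ mu) (hA : ∀ᵐ a ∂A, 0 ≤ a) (hα : HasGeomTail z z α) :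
    IsArrivalStationary mu Y A α := by
  refine isArrivalStationary_iff.2 ⟨hα.isProbabilityMeasure, ?_⟩
  have step := hα.bind_arrivalKernel (Y := Y) hmu hz.pos.le hz.lt_one.le hA
  rw [hz.mgf_eq] at step
  exact step.unique hα

theorem IsDecayRate.hasGeomTail [IsProbabilityMeasure Y] [IsProbabilityMeasure A]
    (hz : IsDecayRate mu Y A z) (hmu : 0 ≤ mu) (hA : ∀ᵐ a ∂A, 0 ≤ a)
    (hα : IsArrivalStationary mu Y A α) : HasGeomTail z z α := by
  obtain ⟨β, hβ⟩ := HasGeomTail.exists_self hz.pos.le hz.lt_one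
  rwa [hα.unique (hz.isArrivalStationary hmu hA hβ)]

theorem IsDecayRate.existsUnique_isArrivalStationary [IsProbabilityMeasure Y]
    [IsProbabilityMeasure A] (hz : IsDecayRate mu Y A z) (hmu : 0 ≤ mu) (hA : ∀ᵐ a ∂A, 0 ≤ a) :
    ∃! α, IsArrivalStationary mu Y A α := by
  obtain ⟨α, hα⟩ := HasGeomTail.exists_self hz.pos.le hz.lt_one
  have hα := hz.isArrivalStationary hmu hA hα
  exact ⟨α, hα, fun β hβ => hβ.unique hα⟩

theorem IsDecayRate.unique [IsProbabilityMeasure Y] [IsProbabilityMeasure A]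
    (hz : IsDecayRate mu Y A z) (hw : IsDecayRate mu Y A w) (hmu : 0 ≤ mu)
    (hA : ∀ᵐ a ∂A, 0 ≤ a) : z = w := by
  obtain ⟨α, hα⟩ := HasGeomTail.exists_self hz.pos.le hz.lt_one
  have hα' := hw.hasGeomTail hmu hA (hz.isArrivalStationary hmu hA hα)
  rw [← hα.real_Ici_one, hα'.real_Ici_one]

theorem HasGeomTail.meanSojourn_eq [IsProbabilityMeasure Y] (hα : HasGeomTail z z α)
    (hmu : 0 ≤ mu) (hz : 0 ≤ z) (hz1 : z ≤ 1) (hγ : 0 < serviceExponent mu Y z) :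
    meanSojourn mu Y α = ENNReal.ofReal (1 / serviceExponent mu Y z) := by
  have := hα.isProbabilityMeasure
  have still_present (t : ℝ) (ht : t ∈ Set.Ioi 0) :
      ∫⁻ n, afterService mu Y (n + 1) t (Set.Ioi 0) ∂α
        = ENNReal.ofReal (Real.exp (-serviceExponent mu Y z * t)) := by
    have tail := (hα.map_add_one.bind_afterService (Y := Y) hmu hz hz1 (le_of_lt ht)).measure_Ici 0
    rw [Measure.bind_apply measurableSet_Ici Measurable.of_discrete.aemeasurable,
      lintegral_map Measurable.of_discrete Measurable.of_discrete] at tail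
    rw [neg_mul, show Set.Ioi 0 = Set.Ici (0 + 1) from rfl]
    simpa only [one_mul, pow_zero, mul_one] using tail
  simp_rw [meanSojourn, meanSojournGiven]
  rw [lintegral_lintegral_swap (measurable_from_prod_countable_right fun n =>
      measurable_afterService_apply (n + 1) _).aemeasurable,
    setLIntegral_congr_fun measurableSet_Ioi still_present,
    ← ofReal_integral_eq_lintegral_ofReal (integrableOn_exp_mul_Ioi (by linarith) 0)
      (ae_of_all _ fun t => (Real.exp_pos _).le),
    integral_exp_mul_Ioi (by linarith)]
  simp [neg_div_neg_eq]

theorem norm_exp_mul_le_one {t a : ℝ} (ht : t ≤ 0) (ha : 0 ≤ a) : ‖Real.exp (t * a)‖ ≤ 1 := by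
  rw [Real.norm_of_nonneg (Real.exp_pos _).le, Real.exp_le_one_iff]
  exact mul_nonpos_of_nonpos_of_nonneg ht ha

theorem mgf_pos_of_nonpos [IsProbabilityMeasure A] (hA : ∀ᵐ a ∂A, 0 ≤ a) {t : ℝ} (ht : t ≤ 0) :
    0 < mgf id A t :=
  mgf_pos (.of_bound (by fun_prop) 1 (hA.mono fun _ ha => norm_exp_mul_le_one ht ha))

theorem continuousOn_mgf_Iic [IsProbabilityMeasure A] (hA : ∀ᵐ a ∂A, 0 ≤ a) :
    ContinuousOn (mgf id A) (Set.Iic 0) :=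
  continuousOn_of_dominated (bound := fun _ => 1)
    (fun _ _ => by fun_prop)
    (fun _ ht => hA.mono fun _ ha => norm_exp_mul_le_one ht ha)
    (integrable_const 1) (ae_of_all _ fun a => by fun_prop)

theorem exists_isDecayRate_le [IsProbabilityMeasure Y] [IsProbabilityMeasure A] (hmu : 0 ≤ mu)
    (hA : ∀ᵐ a ∂A, 0 ≤ a) (hz : 0 ≤ z) (hz1 : z < 1)
    (hmgf : mgf id A (-serviceExponent mu Y z) ≤ z) : ∃ w ≤ z, IsDecayRate mu Y A w := by
  have subset : Set.Icc 0 z ⊆ Set.Icc 0 1 := Set.Icc_subset_Icc_right hz1.le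
  have nonpos {w : ℝ} (hw : w ∈ Set.Icc 0 z) : -serviceExponent mu Y w ≤ 0 :=
    neg_nonpos.2 (serviceExponent_nonneg hmu hw.1 (subset hw).2)
  have continuous : ContinuousOn (fun w => mgf id A (-serviceExponent mu Y w)) (Set.Icc 0 z) :=
    (continuousOn_mgf_Iic hA).comp (continuousOn_serviceExponent.mono subset).neg fun w hw =>
      nonpos hw
  have mgf_pos {w : ℝ} (hw : w ∈ Set.Icc 0 z) : 0 < mgf id A (-serviceExponent mu Y w) :=
    mgf_pos_of_nonpos hA (nonpos hw)
  obtain ⟨w, hw, hfix⟩ := isPreconnected_Icc.intermediate_value₂ (Set.right_mem_Icc.2 hz)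
    (Set.left_mem_Icc.2 hz) continuous continuousOn_id hmgf (mgf_pos (Set.left_mem_Icc.2 hz)).le
  exact ⟨w, hw.2, (mgf_pos hw).trans_eq hfix, hw.2.trans_lt hz1, hfix⟩

theorem IsDecayRate.le_of_mgf_le [IsProbabilityMeasure Y] [IsProbabilityMeasure A]
    [IsProbabilityMeasure B] (hz : IsDecayRate mu Y A z) (hw : IsDecayRate mu Y B w) (hmu : 0 ≤ mu)
    (hB : ∀ᵐ a ∂B, 0 ≤ a) (hBA : ∀ t ≤ 0, mgf id B t ≤ mgf id A t) : w ≤ z := by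
  have mgf_le : mgf id B (-serviceExponent mu Y z) ≤ z :=
    (hBA _ (neg_nonpos.2 (hz.serviceExponent_pos hmu).le)).trans_eq hz.mgf_eq
  obtain ⟨w', hw'z, hw'⟩ := exists_isDecayRate_le hmu hB hz.pos.le hz.lt_one mgf_le
  exact hw.unique hw' hmu hB ▸ hw'z

end EmbeddedChain

/-! ### The queue with Erlang inter-arrival times -/

section Erlang

variable {lam mu : ℝ} {Y : Measure ℕ} {k : ℕ} {z : ℝ}

theorem hasSum_real_singleton_mul {S R : Type*} [MeasurableSpace S] [MeasurableSpace R]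
    [Countable S] [MeasurableSingletonClass S] [MeasurableSingletonClass R] (κ : Kernel S R)
    [IsFiniteKernel κ] (p : Measure S) [IsFiniteMeasure p] (r : R) :
    HasSum (fun s => p.real {s} * (κ s).real {r}) ((κ ∘ₘ p).real {r}) := by
  have hsum := bind_apply_singleton_eq_tsum p κ r
  have hfin : ∑' s, p {s} * κ s {r} ≠ ∞ := hsum ▸ measure_ne_top _ _
  rw [measureReal_def, hsum, ENNReal.tsum_toReal_eq (ENNReal.ne_top_of_tsum_ne_top hfin)]
  simpa only [ENNReal.toReal_mul, measureReal_def] using (ENNReal.summable_toReal hfin).hasSum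

/-- The jump chain of the uniformization of the queue with Erlang inter-arrival times: at the events
of a Poisson process of rate `k * lam + mu`, an arrival phase or a service is completed, with
probabilities proportional to `k * lam` and `mu`. -/
def erlangKernel (lam mu : ℝ) (Y : Measure ℕ) (k : ℕ) : Kernel (ℕ × Fin k) (ℕ × Fin k) :=
  Kernel.ofFunOfCountable fun s =>
    ENNReal.ofReal (k * lam / (k * lam + mu)) • Measure.dirac (nextPhase s) +
      ENNReal.ofReal (mu / (k * lam + mu)) • (Y.map fun j => s.1 - j).map fun m => (m, s.2)

theorem erlangKernel_apply (s : ℕ × Fin k) :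
    erlangKernel lam mu Y k s = ENNReal.ofReal (k * lam / (k * lam + mu)) •
        Measure.dirac (nextPhase s) +
      ENNReal.ofReal (mu / (k * lam + mu)) • (Y.map fun j => s.1 - j).map fun m => (m, s.2) := rfl

theorem isMarkovKernel_erlangKernel [IsProbabilityMeasure Y] (hlam : 0 ≤ lam) (hmu : 0 < mu) :
    IsMarkovKernel (erlangKernel lam mu Y k) := by
  refine ⟨fun s => ⟨?_⟩⟩
  rw [erlangKernel_apply, Measure.map_map Measurable.of_discrete Measurable.of_discrete]
  have := Measure.isProbabilityMeasure_map (μ := Y)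
    (Measurable.of_discrete (f := (fun m => (m, s.2)) ∘ fun j => s.1 - j)).aemeasurable
  simp only [Measure.add_apply, Measure.smul_apply, measure_univ, smul_eq_mul, mul_one]
  rw [← ENNReal.ofReal_add (by positivity) (by positivity), ← add_div, div_self (by positivity),
    ENNReal.ofReal_one]

theorem map_prodMk_real_singleton (ν : Measure ℕ) (i : Fin k) (s : ℕ × Fin k) :
    (ν.map fun m => (m, i)).real {s} = if s.2 = i then ν.real {s.1} else 0 := by
  rw [map_measureReal_apply Measurable.of_discrete .of_discrete]
  split_ifs with h
  · rw [show (fun m => (m, i)) ⁻¹' {s} = {s.1} by ext m; simp [Prod.ext_iff, h]]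
  · rw [show (fun m => (m, i)) ⁻¹' {s} = ∅ by ext m; simp [Prod.ext_iff, Ne.symm h],
      measureReal_empty]

theorem dirac_real_singleton {S : Type*} [MeasurableSpace S] [MeasurableSingletonClass S]
    [DecidableEq S] (s s' : S) : (Measure.dirac s).real {s'} = if s' = s then 1 else 0 := by
  rw [measureReal_def, Measure.dirac_apply' _ (measurableSet_singleton _)]
  by_cases h : s' = s
  · simp [h]
  · simp [h, Ne.symm h]

theorem erlangGenerator_eq [IsFiniteMeasure Y] (hlam : 0 ≤ lam) (hmu : 0 < mu)
    (s s' : ℕ × Fin k) :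
    erlangGenerator lam mu Y k s s' =
      (k * lam + mu) * ((erlangKernel lam mu Y k s).real {s'} - (Measure.dirac s).real {s'}) := by
  have jump_finite := Measure.smul_finite (Measure.dirac (nextPhase s))
    (c := ENNReal.ofReal (k * lam / (k * lam + mu))) ENNReal.ofReal_ne_top
  have serve_finite := Measure.smul_finite ((Y.map fun j => s.1 - j).map fun m => (m, s.2))
    (c := ENNReal.ofReal (mu / (k * lam + mu))) ENNReal.ofReal_ne_top
  have kernel_real : (erlangKernel lam mu Y k s).real {s'} =
      k * lam / (k * lam + mu) * (if s' = nextPhase s then 1 else 0) + mu / (k * lam + mu) *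
        (if s'.2 = s.2 then (Y.map fun j => s.1 - j).real {s'.1} else 0) := by
    rw [erlangKernel_apply, measureReal_add_apply, measureReal_ennreal_smul_apply,
      measureReal_ennreal_smul_apply, map_prodMk_real_singleton, dirac_real_singleton,
      ENNReal.toReal_ofReal (by positivity), ENNReal.toReal_ofReal (by positivity)]
  rw [kernel_real, dirac_real_singleton, erlangGenerator]
  field_simp
  ring

theorem isErlangStationary_iff [IsProbabilityMeasure Y] (hlam : 0 ≤ lam) (hmu : 0 < mu)
    {P : Measure (ℕ × Fin k)} :
    IsErlangStationary lam mu Y k P ↔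
      IsProbabilityMeasure P ∧ (erlangKernel lam mu Y k).Invariant P := by
  refine and_congr_right fun _ => ?_
  have := isMarkovKernel_erlangKernel (k := k) (Y := Y) hlam hmu
  have rate_ne_zero : k * lam + mu ≠ 0 := by positivity
  have flow (s' : ℕ × Fin k) : HasSum (fun s => P.real {s} * erlangGenerator lam mu Y k s s')
      ((k * lam + mu) * ((erlangKernel lam mu Y k ∘ₘ P).real {s'} - P.real {s'})) := by
    have hjump := hasSum_real_singleton_mul (erlangKernel lam mu Y k) P s'
    have hstay := hasSum_real_singleton_mul Kernel.id P s'
    simp_rw [Measure.id_comp, Kernel.id_apply] at hstay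
    refine ((hjump.sub hstay).mul_left (k * lam + mu)).congr_fun fun s => ?_
    rw [erlangGenerator_eq hlam hmu]
    ring
  have hasSum_zero_iff (s' : ℕ × Fin k) :
      HasSum (fun s => P.real {s} * erlangGenerator lam mu Y k s s') 0 ↔
        (erlangKernel lam mu Y k ∘ₘ P) {s'} = P {s'} := by
    have hasSum_iff : HasSum (fun s => P.real {s} * erlangGenerator lam mu Y k s s') 0 ↔
        (k * lam + mu) * ((erlangKernel lam mu Y k ∘ₘ P).real {s'} - P.real {s'}) = 0 :=
      ⟨fun h => (flow s').unique h, fun h => h ▸ flow s'⟩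
    rw [hasSum_iff, mul_eq_zero_iff_left rate_ne_zero, sub_eq_zero,
      measureReal_eq_measureReal_iff]
  simp_rw [hasSum_zero_iff, Kernel.Invariant, Measure.ext_iff_singleton]

theorem divModEquiv_symm_nextPhase [NeZero k] (s : ℕ × Fin k) :
    (Nat.divModEquiv k).symm (nextPhase s) = (Nat.divModEquiv k).symm s + 1 := by
  simp only [Nat.divModEquiv, Equiv.coe_fn_symm_mk, nextPhase]
  split_ifs with h
  · simp only [add_assoc]
  · have : (s.2 : ℕ) + 1 = k := by omega
    rw [add_mul, one_mul, Fin.val_mk, add_zero, add_assoc, this]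

theorem divModEquiv_symm_iterate_nextPhase [NeZero k] (i : ℕ) (s : ℕ × Fin k) :
    (Nat.divModEquiv k).symm (nextPhase^[i] s) = (Nat.divModEquiv k).symm s + i := by
  induction i with
  | zero => rfl
  | succ i ih => rw [Function.iterate_succ_apply', divModEquiv_symm_nextPhase, ih, add_assoc]

theorem IsErlangStationary.unique [NeZero k] [IsProbabilityMeasure Y] (hlam : 0 < lam)
    (hmu : 0 < mu) {P Q : Measure (ℕ × Fin k)} (hP : IsErlangStationary lam mu Y k P)
    (hQ : IsErlangStationary lam mu Y k Q) : P = Q := by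
  have := isMarkovKernel_erlangKernel (k := k) (Y := Y) hlam.le hmu
  have := hP.1
  have := hQ.1
  have jump (s : ℕ × Fin k) : erlangKernel lam mu Y k s {nextPhase s} ≠ 0 := by
    have : 0 < k * lam / (k * lam + mu) := by
      have := NeZero.pos k
      positivity
    simp [erlangKernel_apply, this]
  refine invariant_unique jump (fun s t => ⟨(Nat.divModEquiv k).symm t,
    (Nat.divModEquiv k).symm s, (Nat.divModEquiv k).symm.injective ?_⟩)
    ((isErlangStationary_iff hlam.le hmu).1 hP).2 ((isErlangStationary_iff hlam.le hmu).1 hQ).2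
  rw [divModEquiv_symm_iterate_nextPhase, divModEquiv_symm_iterate_nextPhase, add_comm]

/-- The law of a pair whose second component, the phase, is uniform on `Fin k`, and whose first
component has law `Γ i` given that the phase is `i`. -/
def phaseMixture (k : ℕ) (Γ : ℕ → Measure ℕ) : Measure (ℕ × Fin k) :=
  ∑ i : Fin k, (k : ℝ≥0∞)⁻¹ • (Γ i).map fun m => (m, i)

theorem phaseMixture_apply (Γ : ℕ → Measure ℕ) (B : Set (ℕ × Fin k)) :
    phaseMixture k Γ B = ∑ i : Fin k, (k : ℝ≥0∞)⁻¹ * Γ i {m | (m, i) ∈ B} := by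
  simp only [phaseMixture, Measure.finsetSum_apply, Measure.smul_apply, smul_eq_mul]
  exact Finset.sum_congr rfl fun i _ => by rw [Measure.map_apply .of_discrete .of_discrete]; rfl

theorem lintegral_phaseMixture (Γ : ℕ → Measure ℕ) (f : ℕ × Fin k → ℝ≥0∞) :
    ∫⁻ s, f s ∂(phaseMixture k Γ) = ∑ i : Fin k, (k : ℝ≥0∞)⁻¹ * ∫⁻ m, f (m, i) ∂(Γ i) := by
  rw [phaseMixture, lintegral_finsetSum_measure]
  exact Finset.sum_congr rfl fun i _ => by
    rw [lintegral_smul_measure, lintegral_map .of_discrete .of_discrete, smul_eq_mul]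

theorem phaseMixture_map_nextPhase [NeZero k] {Γ : ℕ → Measure ℕ}
    (hΓ : (Γ k).map (· + 1) = Γ 0) :
    (phaseMixture k fun i => Γ (i + 1)).map nextPhase = phaseMixture k Γ := by
  obtain ⟨k, rfl⟩ := Nat.exists_eq_succ_of_ne_zero (NeZero.ne k)
  ext B -
  have wrap : Γ (k + 1) {m | nextPhase (m, Fin.last k) ∈ B} = Γ 0 {m | (m, 0) ∈ B} := by
    rw [← hΓ, Measure.map_apply .of_discrete .of_discrete]
    simp [nextPhase]
  have advance (i : Fin k) : {m | nextPhase (m, i.castSucc) ∈ B} = {m | (m, i.succ) ∈ B} := by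
    simp [nextPhase, Fin.succ]
  rw [Measure.map_apply .of_discrete .of_discrete, phaseMixture_apply, phaseMixture_apply,
    Fin.sum_univ_castSucc, Fin.sum_univ_succ, add_comm]
  congr 2
  exact funext fun i => by rw [← advance]; rfl

theorem phaseMixture_bind_serve (Γ : ℕ → Measure ℕ) :
    ((phaseMixture k Γ).bind fun s => (Y.map fun j => s.1 - j).map fun m => (m, s.2))
      = phaseMixture k fun i => (Γ i).bind fun n => Y.map fun j => n - j := by
  ext B hB
  rw [Measure.bind_apply hB Measurable.of_discrete.aemeasurable, lintegral_phaseMixture,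
    phaseMixture_apply]
  refine Finset.sum_congr rfl fun i _ => ?_
  rw [Measure.bind_apply .of_discrete Measurable.of_discrete.aemeasurable]
  simp_rw [Measure.map_apply .of_discrete hB]
  rfl

theorem erlangKernel_comp (P : Measure (ℕ × Fin k)) :
    erlangKernel lam mu Y k ∘ₘ P = ENNReal.ofReal (k * lam / (k * lam + mu)) • P.map nextPhase +
      ENNReal.ofReal (mu / (k * lam + mu)) •
        P.bind fun s => (Y.map fun j => s.1 - j).map fun m => (m, s.2) := by
  ext B hB
  rw [← Measure.bind_dirac_eq_map P (Measurable.of_discrete (f := nextPhase))]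
  simp only [Measure.add_apply, Measure.smul_apply, smul_eq_mul,
    Measure.bind_apply hB Measurable.of_discrete.aemeasurable, erlangKernel_apply]
  rw [lintegral_add_left .of_discrete, lintegral_const_mul _ .of_discrete,
    lintegral_const_mul _ .of_discrete]

theorem smul_phaseMixture_add_smul (a b : ℝ≥0∞) (Γ Γ' : ℕ → Measure ℕ) :
    a • phaseMixture k Γ + b • phaseMixture k Γ' = phaseMixture k fun i => a • Γ i + b • Γ' i := by
  simp only [phaseMixture, Finset.smul_sum, ← Finset.sum_add_distrib]
  refine Finset.sum_congr rfl fun i _ => ?_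
  rw [Measure.map_add _ _ Measurable.of_discrete, Measure.map_smul, Measure.map_smul, smul_add,
    smul_comm a, smul_comm b]

theorem isProbabilityMeasure_phaseMixture [NeZero k] {Γ : ℕ → Measure ℕ}
    (hΓ : ∀ i, IsProbabilityMeasure (Γ i)) : IsProbabilityMeasure (phaseMixture k Γ) := by
  refine ⟨?_⟩
  rw [phaseMixture_apply]
  simp [ENNReal.mul_inv_cancel, NeZero.ne k]

theorem numberLaw_phaseMixture_apply (Γ : ℕ → Measure ℕ) (B : Set ℕ) :
    numberLaw (phaseMixture k Γ) B = ∑ i : Fin k, (k : ℝ≥0∞)⁻¹ * Γ i B := by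
  rw [numberLaw, Measure.map_apply .of_discrete .of_discrete, phaseMixture_apply]
  rfl

theorem hasGeomTail_numberLaw_phaseMixture [NeZero k] {Γ : ℕ → Measure ℕ} {q : ℕ → ℝ}
    (hΓ : ∀ i, HasGeomTail z (q i) (Γ i)) :
    HasGeomTail z ((∑ i ∈ Finset.range k, q i) / k) (numberLaw (phaseMixture k Γ)) := by
  have := isProbabilityMeasure_phaseMixture (k := k) fun i => (hΓ i).isProbabilityMeasure
  refine ⟨Measure.isProbabilityMeasure_map Measurable.of_discrete.aemeasurable, fun M => ?_⟩
  have mass_ne_top (i : Fin k) : (k : ℝ≥0∞)⁻¹ * Γ i (Set.Ici (M + 1)) ≠ ∞ := by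
    have := (hΓ i).isProbabilityMeasure
    exact ENNReal.mul_ne_top (by simp [NeZero.ne k]) (measure_ne_top _ _)
  rw [measureReal_def, numberLaw_phaseMixture_apply, ← Fin.sum_univ_eq_sum_range,
    ENNReal.toReal_sum fun i _ => mass_ne_top i, Finset.sum_div, Finset.sum_mul]
  refine Finset.sum_congr rfl fun i _ => ?_
  rw [ENNReal.toReal_mul, ← measureReal_def, (hΓ i).real_Ici]
  simp
  ring

theorem isErlangStationary_phaseMixture [NeZero k] [IsProbabilityMeasure Y] (hlam : 0 < lam)
    (hmu : 0 < mu) (hz : 0 ≤ z) (hz1 : z ≤ 1) {Γ : ℕ → Measure ℕ}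
    (hΓ : ∀ i, HasGeomTail z ((k * lam / (k * lam + serviceExponent mu Y z)) ^ i) (Γ i))
    (hz_eq : (k * lam / (k * lam + serviceExponent mu Y z)) ^ k = z) :
    IsErlangStationary lam mu Y k (phaseMixture k fun i => Γ (i + 1)) := by
  have hγ := serviceExponent_nonneg (Y := Y) hmu.le hz hz1
  have hG := batchPgf_nonneg (Y := Y) hz
  have hk : (0 : ℝ) < k := Nat.cast_pos.2 (NeZero.pos k)
  set x := k * lam / (k * lam + serviceExponent mu Y z) with hx
  have wrap : (Γ k).map (· + 1) = Γ 0 := by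
    have wrapped : HasGeomTail z z (Γ k) := by simpa only [hz_eq] using hΓ k
    exact wrapped.map_add_one.unique (by simpa only [pow_zero] using hΓ 0)
  have balance_rates : k * lam / (k * lam + mu) + mu / (k * lam + mu) * (x * batchPgf Y z) = x := by
    rw [hx]
    field_simp
    rw [serviceExponent]
    ring
  have phase_balance (i : ℕ) : ENNReal.ofReal (k * lam / (k * lam + mu)) • Γ i +
      ENNReal.ofReal (mu / (k * lam + mu)) • (Γ (i + 1)).bind (fun n => Y.map fun j => n - j) =
        Γ (i + 1) := by
    have served := (hΓ (i + 1)).bind_map_sub hz Y hG (lintegral_ofReal_pow hz hz1)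
    have mixed := (hΓ i).convexComb served (a := k * lam / (k * lam + mu))
      (b := mu / (k * lam + mu)) (by positivity) (by positivity)
      (by rw [← add_div, div_self (by positivity)])
    refine mixed.unique ?_
    convert hΓ (i + 1) using 1
    linear_combination x ^ i * balance_rates
  refine (isErlangStationary_iff hlam.le hmu).2
    ⟨isProbabilityMeasure_phaseMixture fun i => (hΓ (i + 1)).isProbabilityMeasure, ?_⟩
  rw [Kernel.Invariant, erlangKernel_comp, phaseMixture_map_nextPhase wrap, phaseMixture_bind_serve,
    smul_phaseMixture_add_smul]
  simp_rw [phase_balance]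

theorem ae_nonneg_gammaMeasure (a r : ℝ) : ∀ᵐ x ∂(gammaMeasure a r), 0 ≤ x := by
  simp_rw [ae_iff, not_le]
  exact (withDensity_apply _ measurableSet_Iio).trans (lintegral_gammaPDF_of_nonpos le_rfl)

theorem gammaPDFReal_mul_exp {a r t : ℝ} (hr : 0 < r) (ht : t < r) (x : ℝ) :
    gammaPDFReal a r x * Real.exp (t * x) = (r / (r - t)) ^ a * gammaPDFReal a (r - t) x := by
  have hrt : 0 < r - t := sub_pos.2 ht
  unfold gammaPDFReal
  split_ifs with hx
  · have exp_add : Real.exp (-((r - t) * x)) = Real.exp (-(r * x)) * Real.exp (t * x) := by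
      rw [← Real.exp_add]
      ring_nf
    have : (r - t) ^ a ≠ 0 := (Real.rpow_pos_of_pos hrt a).ne'
    rw [Real.div_rpow hr.le hrt.le, exp_add]
    field_simp
  · simp

theorem mgf_gammaMeasure {a r t : ℝ} (ha : 0 < a) (hr : 0 < r) (ht : t < r) :
    mgf id (gammaMeasure a r) t = (r / (r - t)) ^ a := by
  have hrt : 0 < r - t := sub_pos.2 ht
  have integral_pdf : ∫ x, gammaPDFReal a (r - t) x = 1 := by
    rw [integral_eq_lintegral_of_nonneg_ae (ae_of_all _ (gammaPDFReal_nonneg ha hrt))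
      (measurable_gammaPDFReal a _).aestronglyMeasurable]
    exact congrArg ENNReal.toReal (lintegral_gammaPDF_eq_one ha hrt)
  have measurable_pdf : Measurable (gammaPDF a r) := (measurable_gammaPDFReal a r).ennreal_ofReal
  rw [mgf, gammaMeasure, integral_withDensity_eq_integral_toReal_smul measurable_pdf
    (ae_of_all _ fun x => ENNReal.ofReal_lt_top)]
  simp_rw [gammaPDF, ENNReal.toReal_ofReal (gammaPDFReal_nonneg ha hr _), smul_eq_mul, id,
    gammaPDFReal_mul_exp hr ht, integral_const_mul, integral_pdf, mul_one]

theorem IsDecayRate.exists_isErlangStationary [NeZero k] [IsProbabilityMeasure Y] (hlam : 0 < lam)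
    (hmu : 0 < mu) (hz : IsDecayRate mu Y (gammaMeasure k (k * lam)) z) :
    ∃ P, IsErlangStationary lam mu Y k P ∧
      HasGeomTail z (lam / serviceExponent mu Y z * (1 - z)) (numberLaw P) := by
  have hk : (0 : ℝ) < k := Nat.cast_pos.2 (NeZero.pos k)
  have := isProbabilityMeasure_gammaMeasure hk (mul_pos hk hlam)
  have hγ := hz.serviceExponent_pos hmu.le
  have hz_eq : (k * lam / (k * lam + serviceExponent mu Y z)) ^ k = z := by
    have mgf_eq := hz.mgf_eq
    rwa [mgf_gammaMeasure hk (mul_pos hk hlam) (by nlinarith [mul_pos hk hlam]), sub_neg_eq_add,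
      Real.rpow_natCast] at mgf_eq
  set x := k * lam / (k * lam + serviceExponent mu Y z) with hx
  have hx0 : 0 ≤ x := by positivity
  have hx1 : x < 1 := (div_lt_one (by positivity)).2 (by linarith)
  choose Γ hΓ using fun i : ℕ =>
    HasGeomTail.exists_of_le_one hz.pos.le hz.lt_one (pow_nonneg hx0 i) (pow_le_one₀ hx0 hx1.le)
  refine ⟨_, isErlangStationary_phaseMixture hlam hmu hz.pos.le hz.lt_one.le hΓ hz_eq, ?_⟩
  have tail := hasGeomTail_numberLaw_phaseMixture (k := k) fun i => hΓ (i + 1)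
  convert tail using 1
  have geom : ∑ i ∈ Finset.range k, x ^ (i + 1) = x * ((1 - z) / (1 - x)) := by
    simp_rw [pow_succ', ← Finset.mul_sum, geom_sum_eq hx1.ne, hz_eq, ← neg_sub (1 : ℝ),
      neg_div_neg_eq]
  have odds : x = k * (lam / serviceExponent mu Y z) * (1 - x) := by
    rw [hx]
    field_simp
    ring
  have : 1 - x ≠ 0 := (sub_pos.2 hx1).ne'
  rw [geom, eq_div_iff hk.ne', ← mul_div_assoc, eq_div_iff this]
  linear_combination -(1 - z) * odds

theorem IsDecayRate.existsUnique_isErlangStationary [NeZero k] [IsProbabilityMeasure Y]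
    (hlam : 0 < lam) (hmu : 0 < mu) (hz : IsDecayRate mu Y (gammaMeasure k (k * lam)) z) :
    ∃! P, IsErlangStationary lam mu Y k P := by
  obtain ⟨P, hP, -⟩ := hz.exists_isErlangStationary hlam hmu
  exact ⟨P, hP, fun Q hQ => hQ.unique hlam hmu hP⟩

theorem IsDecayRate.hasGeomTail_numberLaw_erlang [NeZero k] [IsProbabilityMeasure Y]
    (hlam : 0 < lam) (hmu : 0 < mu) (hz : IsDecayRate mu Y (gammaMeasure k (k * lam)) z)
    {P : Measure (ℕ × Fin k)} (hP : IsErlangStationary lam mu Y k P) :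
    HasGeomTail z (lam / serviceExponent mu Y z * (1 - z)) (numberLaw P) := by
  obtain ⟨Q, hQ, tail⟩ := hz.exists_isErlangStationary hlam hmu
  rwa [hP.unique hlam hmu hQ]

end Erlang

/-! ### The queue with deterministic inter-arrival times -/

section Deterministic

variable {mu : ℝ} {Y : Measure ℕ} {T z : ℝ}

/-- The time that has passed since the last arrival at time `x`, when customers arrive at the times
`0, T, 2 * T, …`. -/
def age (T x : ℝ) : ℝ := x - ⌊x / T⌋₊ * T

/-- The uniform distribution on `[0, T)`, the stationary law of the time since the last arrival. -/
def uniformAge (T : ℝ) : Measure ℝ := volume[|Set.Ico 0 T]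

theorem isProbabilityMeasure_uniformAge (hT : 0 < T) : IsProbabilityMeasure (uniformAge T) :=
  cond_isProbabilityMeasure_of_finite (by simpa using hT) (by simp)

theorem ae_mem_Ico_uniformAge : ∀ᵐ a ∂(uniformAge T), a ∈ Set.Ico 0 T :=
  ae_cond_mem measurableSet_Ico

theorem measurable_age : Measurable (age T) := by
  have : Measurable fun x : ℝ => (⌊x / T⌋₊ : ℝ) :=
    measurable_from_nat.comp (Nat.measurable_floor.comp (by fun_prop))
  unfold age
  fun_prop

theorem age_mem_Ico (hT : 0 < T) {x : ℝ} (hx : 0 ≤ x) : age T x ∈ Set.Ico 0 T := by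
  have floor_le := (le_div_iff₀ hT).1 (Nat.floor_le (div_nonneg hx hT.le))
  have lt_floor := (div_lt_iff₀ hT).1 (Nat.lt_floor_add_one (x / T))
  exact ⟨sub_nonneg.2 floor_le, by rw [age]; linarith⟩

theorem floor_div_eq_zero {a : ℝ} (ha : a ∈ Set.Ico 0 T) : ⌊a / T⌋₊ = 0 :=
  Nat.floor_eq_zero.2 ((div_lt_one (ha.1.trans_lt ha.2)).2 ha.2)

theorem age_of_mem_Ico {a : ℝ} (ha : a ∈ Set.Ico 0 T) : age T a = a := by
  simp [age, floor_div_eq_zero ha]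

theorem floor_add_period_div {a : ℝ} (ha : a ∈ Set.Ico 0 T) : ⌊(a + T) / T⌋₊ = 1 := by
  have hT := ha.1.trans_lt ha.2
  rw [add_div, div_self hT.ne', Nat.floor_add_one (div_nonneg ha.1 hT.le), floor_div_eq_zero ha]

theorem equivIco_coe_eq_age [Fact (0 < T)] {x : ℝ} (hx : 0 ≤ x) :
    (AddCircle.equivIco T 0 x : ℝ) = age T x := by
  have hT : 0 < T := Fact.out
  rw [AddCircle.coe_equivIco_mk_apply, Int.fract, sub_mul, div_mul_cancel₀ _ hT.ne', age,
    natCast_floor_eq_intCast_floor (by positivity)]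

-- `age T` identifies `[0, T)` with the circle of length `T`, whose Haar measure is invariant under
-- rotations.
theorem setLIntegral_age_add (hT : 0 < T) {c : ℝ} (hc : 0 ≤ c) (f : ℝ → ℝ≥0∞) :
    ∫⁻ a in Set.Ico 0 T, f (age T (a + c)) = ∫⁻ a in Set.Ico 0 T, f a := by
  have : Fact (0 < T) := ⟨hT⟩
  set F : AddCircle T → ℝ≥0∞ := fun b => f (AddCircle.equivIco T 0 b) with hF
  have lintegral_circle (c : ℝ) (hc : 0 ≤ c) :
      ∫⁻ a in Set.Ico 0 T, f (age T (a + c)) = ∫⁻ b, F b := by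
    calc ∫⁻ a in Set.Ico 0 T, f (age T (a + c))
        = ∫⁻ a in Set.Ico 0 T, F ((a : AddCircle T) + (c : AddCircle T)) :=
          setLIntegral_congr_fun measurableSet_Ico fun a ha => by
            rw [hF, ← equivIco_coe_eq_age (add_nonneg ha.1 hc), AddCircle.coe_add]
      _ = ∫⁻ a in Set.Ioc 0 (0 + T), F ((a : AddCircle T) + (c : AddCircle T)) := by
          rw [zero_add, Measure.restrict_congr_set Ico_ae_eq_Ioc]
      _ = ∫⁻ b, F (b + (c : AddCircle T)) :=
          AddCircle.lintegral_preimage T 0 fun b => F (b + (c : AddCircle T))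
      _ = ∫⁻ b, F b := lintegral_add_right_eq_self _ _
  rw [lintegral_circle c hc, ← lintegral_circle 0 le_rfl]
  exact setLIntegral_congr_fun measurableSet_Ico fun a ha => by rw [add_zero, age_of_mem_Ico ha]

theorem lintegral_uniformAge_age_add (hT : 0 < T) {c : ℝ} (hc : 0 ≤ c) (f : ℝ → ℝ≥0∞) :
    ∫⁻ a, f (age T (a + c)) ∂(uniformAge T) = ∫⁻ a, f a ∂(uniformAge T) := by
  rw [uniformAge, ProbabilityTheory.cond, lintegral_smul_measure, lintegral_smul_measure,
    setLIntegral_age_add hT hc]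

theorem integral_exp_uniformAge (hT : 0 < T) {γ : ℝ} (hγ : γ ≠ 0) :
    ∫ a, Real.exp (-(γ * a)) ∂(uniformAge T) = (1 - Real.exp (-(γ * T))) / (γ * T) := by
  have integral_Ioc : ∫ a in (0 : ℝ)..T, Real.exp (-(γ * a)) = (1 - Real.exp (-(γ * T))) / γ := by
    simp_rw [← neg_mul]
    rw [intervalIntegral.integral_comp_mul_left _ (neg_ne_zero.2 hγ), integral_exp]
    simp only [mul_zero, Real.exp_zero, smul_eq_mul]
    field_simp
    ring
  rw [uniformAge, ProbabilityTheory.cond, integral_smul_measure,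
    Measure.restrict_congr_set Ico_ae_eq_Ioc, ← intervalIntegral.integral_of_le hT.le, integral_Ioc]
  simp [hT.le]
  field_simp

theorem measurable_afterArrival (n i : ℕ) : Measurable fun a => afterArrival mu Y T n a i := by
  induction i with
  | zero =>
    exact (Measure.measurable_map _ Measurable.of_discrete).comp
      ((measurable_afterService n).comp (by fun_prop))
  | succ i ih => exact measurable_bind_of_countable ih fun m => measurable_const

theorem measurable_numberAt (t : ℝ) (n i : ℕ) : Measurable fun a => numberAt mu Y T t n a i := by
  cases i with
  | zero => exact measurable_const
  | succ i =>
    exact measurable_bind_of_countable (measurable_afterArrival n i) fun m =>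
      (measurable_afterService m).comp (by fun_prop)

theorem measurable_deterministicTransition (t : ℝ) :
    Measurable (deterministicTransition mu Y T t) := by
  refine measurable_from_prod_countable_right fun n => ?_
  simp_rw [deterministicTransition, ← Measure.bind_dirac_eq_map _ Measurable.of_discrete]
  have floor : Measurable fun a : ℝ => ⌊(a + t) / T⌋₊ := Nat.measurable_floor.comp (by fun_prop)
  have number : Measurable fun x : ℕ × ℝ => numberAt mu Y T t n x.2 x.1 :=
    measurable_from_prod_countable_right (measurable_numberAt t n)
  exact measurable_bind_of_countable (number.comp (floor.prodMk measurable_id)) fun m =>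
    Measure.measurable_dirac.comp
      (measurable_const.prodMk (measurable_age.comp (measurable_id.add_const t)))

theorem deterministicTransition_apply (t : ℝ) (s : ℕ × ℝ) {B : Set (ℕ × ℝ)} (hB : MeasurableSet B) :
    deterministicTransition mu Y T t s B =
      numberAt mu Y T t s.1 s.2 ⌊(s.2 + t) / T⌋₊ {m | (m, age T (s.2 + t)) ∈ B} :=
  Measure.map_apply Measurable.of_discrete hB

instance [IsProbabilityMeasure Y] (n : ℕ) (a : ℝ) (i : ℕ) :
    IsProbabilityMeasure (afterArrival mu Y T n a i) := by
  induction i with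
  | zero => exact Measure.isProbabilityMeasure_map Measurable.of_discrete.aemeasurable
  | succ i ih =>
    exact isProbabilityMeasure_bind Measurable.of_discrete (ae_of_all _ fun m =>
      Measure.isProbabilityMeasure_map Measurable.of_discrete.aemeasurable)

instance [IsProbabilityMeasure Y] (t : ℝ) (n : ℕ) (a : ℝ) (i : ℕ) :
    IsProbabilityMeasure (numberAt mu Y T t n a i) := by
  cases i with
  | zero => exact inferInstanceAs (IsProbabilityMeasure (afterService mu Y n t))
  | succ i =>
    exact isProbabilityMeasure_bind Measurable.of_discrete (ae_of_all _ fun m => inferInstance)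

theorem lintegral_deterministicTransition (ν : Measure ℝ) [SFinite ν] (κ : Kernel ℝ ℕ)
    [IsSFiniteKernel κ] (t : ℝ) {B : Set (ℕ × ℝ)} (hB : MeasurableSet B) :
    ∫⁻ s, deterministicTransition mu Y T t s B ∂((ν ⊗ₘ κ).map Prod.swap) =
      ∫⁻ a, ((κ a).bind fun n => numberAt mu Y T t n a ⌊(a + t) / T⌋₊)
        {m | (m, age T (a + t)) ∈ B} ∂ν := by
  have measurable_apply : Measurable fun s => deterministicTransition mu Y T t s B :=
    (Measure.measurable_coe hB).comp (measurable_deterministicTransition t)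
  rw [lintegral_map measurable_apply measurable_swap,
    Measure.lintegral_compProd (f := fun s => deterministicTransition mu Y T t s.swap B)
      (measurable_apply.comp measurable_swap)]
  refine lintegral_congr fun a => ?_
  rw [Measure.bind_apply .of_discrete Measurable.of_discrete.aemeasurable]
  simp_rw [deterministicTransition_apply t _ hB, Prod.fst_swap, Prod.snd_swap]

theorem HasGeomTail.bind_map_add_one {p : Measure ℕ} {f : ℕ → Measure ℕ}
    (h : HasGeomTail z z (p.bind f)) : HasGeomTail z 1 (p.bind fun n => (f n).map (· + 1)) := by
  have map_bind : (p.bind fun n => (f n).map (· + 1)) = (p.bind f).map (· + 1) := by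
    simp_rw [← Measure.bind_dirac_eq_map _ (Measurable.of_discrete (f := fun m : ℕ => m + 1))]
    rw [Measure.bind_bind Measurable.of_discrete.aemeasurable Measurable.of_discrete.aemeasurable]
  exact map_bind ▸ h.map_add_one

theorem HasGeomTail.bind_afterArrival [IsProbabilityMeasure Y] {p : Measure ℕ} {a : ℝ}
    (hp : HasGeomTail z (Real.exp (-(serviceExponent mu Y z * a))) p) (hmu : 0 ≤ mu) (hz : 0 ≤ z)
    (hz1 : z ≤ 1) (hT : 0 ≤ T) (hz_eq : Real.exp (-(serviceExponent mu Y z * T)) = z) (ha : a ≤ T)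
    (i : ℕ) : HasGeomTail z 1 (p.bind fun n => afterArrival mu Y T n a i) := by
  induction i with
  | zero =>
    have tail := hp.bind_afterService (Y := Y) hmu hz hz1 (sub_nonneg.2 ha)
    refine bind_map_add_one ?_
    convert tail using 1
    rw [← Real.exp_add, ← neg_add, ← mul_add, add_sub_cancel, hz_eq]
  | succ i ih =>
    simp only [afterArrival]
    rw [← Measure.bind_bind Measurable.of_discrete.aemeasurable
      Measurable.of_discrete.aemeasurable]
    have tail := ih.bind_afterService (Y := Y) hmu hz hz1 hT
    rw [one_mul, hz_eq] at tail
    exact bind_map_add_one tail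

theorem HasGeomTail.bind_numberAt [IsProbabilityMeasure Y] {p : Measure ℕ} {a t : ℝ}
    (hp : HasGeomTail z (Real.exp (-(serviceExponent mu Y z * a))) p) (hmu : 0 ≤ mu) (hz : 0 ≤ z)
    (hz1 : z ≤ 1) (hT : 0 ≤ T) (hz_eq : Real.exp (-(serviceExponent mu Y z * T)) = z) (ha : a ≤ T)
    (ht : 0 ≤ t) {i : ℕ} (hi : i * T ≤ a + t) :
    HasGeomTail z (Real.exp (-(serviceExponent mu Y z * (a + t - i * T))))
      (p.bind fun n => numberAt mu Y T t n a i) := by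
  cases i with
  | zero =>
    have tail := hp.bind_afterService (Y := Y) hmu hz hz1 ht
    rwa [← Real.exp_add, ← neg_add, ← mul_add, ← sub_zero (a + t), ← zero_mul T,
      ← Nat.cast_zero] at tail
  | succ i =>
    simp only [numberAt]
    rw [← Measure.bind_bind Measurable.of_discrete.aemeasurable
      Measurable.of_discrete.aemeasurable]
    push_cast at hi ⊢
    simpa only [one_mul] using (hp.bind_afterArrival hmu hz hz1 hT hz_eq ha i).bind_afterService
      hmu hz hz1 (sub_nonneg.2 hi)

/-- The conditional law of the number of customers given the time `a` since the last arrival, when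
the number of customers found by that arrival has law `α`. -/
def numberGivenAge (mu : ℝ) (Y : Measure ℕ) (α : Measure ℕ) : Kernel ℝ ℕ where
  toFun a := (α.map (· + 1)).bind fun n => afterService mu Y n a
  measurable' := by
    have measurable_law : Measurable fun _ : ℝ => α.map (· + 1) := measurable_const
    exact measurable_bind_of_countable measurable_law fun n => measurable_afterService n

theorem numberGivenAge_apply (α : Measure ℕ) (a : ℝ) :
    numberGivenAge mu Y α a = (α.map (· + 1)).bind fun n => afterService mu Y n a := rfl

instance [IsProbabilityMeasure Y] (α : Measure ℕ) [IsProbabilityMeasure α] :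
    IsMarkovKernel (numberGivenAge mu Y α) :=
  have := Measure.isProbabilityMeasure_map (μ := α)
    (Measurable.of_discrete (f := (· + 1))).aemeasurable
  ⟨fun _ => isProbabilityMeasure_bind Measurable.of_discrete (ae_of_all _ fun _ => inferInstance)⟩

theorem hasGeomTail_numberGivenAge [IsProbabilityMeasure Y] {α : Measure ℕ}
    (hα : HasGeomTail z z α) (hmu : 0 ≤ mu) (hz : 0 ≤ z) (hz1 : z ≤ 1) {a : ℝ} (ha : 0 ≤ a) :
    HasGeomTail z (Real.exp (-(serviceExponent mu Y z * a))) (numberGivenAge mu Y α a) := by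
  rw [numberGivenAge_apply]
  simpa only [one_mul] using hα.map_add_one.bind_afterService (Y := Y) hmu hz hz1 ha

theorem isDeterministicStationary_of_flow (hT : 0 < T) (κ : Kernel ℝ ℕ) [IsMarkovKernel κ]
    (flow : ∀ a ∈ Set.Ico 0 T, ∀ t, 0 ≤ t →
      ((κ a).bind fun n => numberAt mu Y T t n a ⌊(a + t) / T⌋₊) = κ (age T (a + t))) :
    IsDeterministicStationary mu Y T ((uniformAge T ⊗ₘ κ).map Prod.swap) := by
  have := isProbabilityMeasure_uniformAge hT
  refine ⟨Measure.isProbabilityMeasure_map measurable_swap.aemeasurable, ?_, fun t ht B hB => ?_⟩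
  · rw [ae_map_iff measurable_swap.aemeasurable (measurable_snd measurableSet_Ico)]
    exact Measure.ae_compProd_of_ae_ae (measurable_fst measurableSet_Ico)
      (ae_mem_Ico_uniformAge.mono fun a ha => ae_of_all _ fun _ => ha)
  · have apply_eq : ((uniformAge T ⊗ₘ κ).map Prod.swap) B =
        ∫⁻ a, κ a {m | (m, a) ∈ B} ∂(uniformAge T) := by
      rw [Measure.map_apply measurable_swap hB, Measure.compProd_apply (measurable_swap hB)]
      rfl
    rw [lintegral_deterministicTransition _ _ _ hB, apply_eq,
      ← lintegral_uniformAge_age_add hT ht fun a => κ a {m | (m, a) ∈ B}]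
    exact lintegral_congr_ae (ae_mem_Ico_uniformAge.mono fun a ha => by simp only [flow a ha t ht])

theorem numberLaw_map_swap_compProd (ν : Measure ℝ) [SFinite ν] (κ : Kernel ℝ ℕ)
    [IsSFiniteKernel κ] : numberLaw ((ν ⊗ₘ κ).map Prod.swap) = κ ∘ₘ ν := by
  rw [numberLaw, Measure.map_map measurable_fst measurable_swap, ← Measure.snd_compProd]
  rfl

theorem IsDecayRate.exists_isDeterministicStationary [IsProbabilityMeasure Y] (hmu : 0 ≤ mu)
    (hT : 0 < T) (hz : IsDecayRate mu Y (Measure.dirac T) z) :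
    ∃ P, IsDeterministicStationary mu Y T P ∧
      HasGeomTail z ((1 - z) / (serviceExponent mu Y z * T)) (numberLaw P) := by
  have := isProbabilityMeasure_uniformAge hT
  have hz_eq : Real.exp (-(serviceExponent mu Y z * T)) = z := by
    simpa [mgf] using hz.mgf_eq
  obtain ⟨α, hα⟩ := HasGeomTail.exists_self hz.pos.le hz.lt_one
  have := hα.isProbabilityMeasure
  have tail {a : ℝ} (ha : 0 ≤ a) :=
    hasGeomTail_numberGivenAge (Y := Y) hα hmu hz.pos.le hz.lt_one.le ha
  refine ⟨_, isDeterministicStationary_of_flow hT (numberGivenAge mu Y α) fun a ha t ht => ?_, ?_⟩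
  · have hage := (age_mem_Ico hT (add_nonneg ha.1 ht)).1
    exact ((tail ha.1).bind_numberAt hmu hz.pos.le hz.lt_one.le hT.le hz_eq ha.2.le ht
      (sub_nonneg.1 hage)).unique (tail hage)
  · have mixed := HasGeomTail.bind (numberGivenAge mu Y α).measurable (by fun_prop) hz.pos.le
      (ae_mem_Ico_uniformAge.mono fun a (ha : a ∈ Set.Ico 0 T) => tail ha.1)
    rwa [integral_exp_uniformAge hT (hz.serviceExponent_pos hmu).ne', hz_eq,
      ← numberLaw_map_swap_compProd] at mixed

theorem IsDeterministicStationary.lintegral_age_add [IsProbabilityMeasure Y] {P : Measure (ℕ × ℝ)}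
    (hP : IsDeterministicStationary mu Y T P) {t : ℝ} (ht : 0 ≤ t) {C : Set ℝ}
    (hC : MeasurableSet C) :
    ∫⁻ s, C.indicator 1 (age T (s.2 + t)) ∂P = P.map Prod.snd C := by
  rw [Measure.map_apply measurable_snd hC, ← hP.2.2 t ht _ (measurable_snd hC)]
  refine lintegral_congr fun s => ?_
  rw [deterministicTransition_apply t s (measurable_snd hC)]
  by_cases h : age T (s.2 + t) ∈ C <;> simp [h]

-- The law of the age is invariant under rotations; averaging over a uniform rotation makes it
-- uniform.
theorem IsDeterministicStationary.map_snd [IsProbabilityMeasure Y] (hT : 0 < T)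
    {P : Measure (ℕ × ℝ)} (hP : IsDeterministicStationary mu Y T P) :
    P.map Prod.snd = uniformAge T := by
  have := hP.1
  have := isProbabilityMeasure_uniformAge hT
  ext C hC
  have rotate {x : ℝ} (hx : x ∈ Set.Ico 0 T) :
      ∫⁻ t, C.indicator 1 (age T (x + t)) ∂(uniformAge T) = uniformAge T C := by
    simp_rw [add_comm x]
    rw [lintegral_uniformAge_age_add hT hx.1 (C.indicator 1), lintegral_indicator_one hC]
  have measurable_rotation : Measurable fun x : ℝ × (ℕ × ℝ) =>
      C.indicator (1 : ℝ → ℝ≥0∞) (age T (x.2.2 + x.1)) :=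
    (measurable_one.indicator hC).comp (measurable_age.comp (by fun_prop))
  calc P.map Prod.snd C
      = ∫⁻ t, ∫⁻ s, C.indicator 1 (age T (s.2 + t)) ∂P ∂(uniformAge T) := by
        rw [lintegral_congr_ae (ae_mem_Ico_uniformAge.mono fun t ht =>
          hP.lintegral_age_add ht.1 hC), lintegral_const, measure_univ, mul_one]
    _ = ∫⁻ s, ∫⁻ t, C.indicator 1 (age T (s.2 + t)) ∂(uniformAge T) ∂P :=
        lintegral_lintegral_swap measurable_rotation.aemeasurable
    _ = uniformAge T C := by
        rw [lintegral_congr_ae (hP.2.1.mono fun s hs => rotate hs), lintegral_const, measure_univ,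
          mul_one]

/-- The transition kernel of the number of customers observed once per inter-arrival time, always at
the time `a` after the last arrival. -/
def skeletonKernel (mu : ℝ) (Y : Measure ℕ) (T a : ℝ) : Kernel ℕ ℕ :=
  Kernel.ofFunOfCountable fun n => numberAt mu Y T T n a 1

theorem skeletonKernel_apply (a : ℝ) (n : ℕ) :
    skeletonKernel mu Y T a n = numberAt mu Y T T n a 1 := rfl

instance [IsProbabilityMeasure Y] (a : ℝ) : IsMarkovKernel (skeletonKernel mu Y T a) :=
  ⟨fun n => inferInstanceAs (IsProbabilityMeasure (numberAt mu Y T T n a 1))⟩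

theorem skeletonKernel_apply_succ_ne_zero (a : ℝ) (n : ℕ) :
    skeletonKernel mu Y T a n {n + 1} ≠ 0 := by
  rw [skeletonKernel_apply, numberAt, afterArrival, bind_apply_singleton_eq_tsum]
  refine fun h => ?_
  rcases mul_eq_zero.1 (ENNReal.tsum_eq_zero.1 h (n + 1)) with h | h
  · rw [Measure.map_apply .of_discrete .of_discrete] at h
    exact afterService_singleton_self_ne_zero n (measure_mono_null (by simp) h)
  · exact afterService_singleton_self_ne_zero _ h

theorem IsDeterministicStationary.exists_kernel [IsProbabilityMeasure Y] (hT : 0 < T)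
    {P : Measure (ℕ × ℝ)} (hP : IsDeterministicStationary mu Y T P) :
    ∃ κ : Kernel ℝ ℕ, IsMarkovKernel κ ∧ P = (uniformAge T ⊗ₘ κ).map Prod.swap ∧
      ∀ᵐ a ∂(uniformAge T), (skeletonKernel mu Y T a).Invariant (κ a) := by
  have := hP.1
  have := isProbabilityMeasure_uniformAge hT
  have := Measure.isProbabilityMeasure_map (μ := P) measurable_swap.aemeasurable
  set κ := (P.map Prod.swap).condKernel
  have disintegrate : P.map Prod.swap = uniformAge T ⊗ₘ κ := by
    rw [← hP.map_snd hT, ← Measure.snd, ← Measure.fst_map_swap, Measure.disintegrate]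
  have hPκ : P = (uniformAge T ⊗ₘ κ).map Prod.swap := by
    rw [← disintegrate, Measure.map_map measurable_swap measurable_swap, Prod.swap_swap_eq,
      Measure.map_id]
  refine ⟨κ, inferInstance, hPκ, ?_⟩
  let η : Kernel ℝ ℕ := ⟨fun a => skeletonKernel mu Y T a ∘ₘ κ a,
    measurable_bind_of_countable κ.measurable fun n => measurable_numberAt T n 1⟩
  have : IsMarkovKernel η :=
    ⟨fun a => inferInstanceAs (IsProbabilityMeasure (skeletonKernel mu Y T a ∘ₘ κ a))⟩
  refine Kernel.ae_eq_of_compProd_eq (κ := η) (Measure.ext fun E hE => ?_)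
  rw [← disintegrate, Measure.map_apply measurable_swap hE, ← hP.2.2 T hT.le _ (measurable_swap hE),
    Measure.compProd_apply hE]
  conv_rhs => rw [hPκ]
  rw [lintegral_deterministicTransition _ _ _ (measurable_swap hE)]
  refine lintegral_congr_ae (ae_mem_Ico_uniformAge.mono fun a ha => ?_)
  have age_eq : age T (a + T) = a := by simp [age, floor_add_period_div ha]
  simp only [floor_add_period_div ha, age_eq]
  rfl

theorem IsDeterministicStationary.unique [IsProbabilityMeasure Y] (hT : 0 < T)
    {P Q : Measure (ℕ × ℝ)} (hP : IsDeterministicStationary mu Y T P)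
    (hQ : IsDeterministicStationary mu Y T Q) : P = Q := by
  obtain ⟨κ, _, rfl, hκ⟩ := hP.exists_kernel hT
  obtain ⟨η, _, rfl, hη⟩ := hQ.exists_kernel hT
  have kernels_eq : ∀ᵐ a ∂(uniformAge T), κ a = η a := by
    filter_upwards [hκ, hη] with a hκa hηa
    exact invariant_unique (skeletonKernel_apply_succ_ne_zero a)
      (fun s t => ⟨t, s, by simp [add_comm]⟩) hκa hηa
  rw [Measure.compProd_congr kernels_eq]

theorem IsDecayRate.existsUnique_isDeterministicStationary [IsProbabilityMeasure Y] (hmu : 0 ≤ mu)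
    (hT : 0 < T) (hz : IsDecayRate mu Y (Measure.dirac T) z) :
    ∃! P, IsDeterministicStationary mu Y T P := by
  obtain ⟨P, hP, -⟩ := hz.exists_isDeterministicStationary hmu hT
  exact ⟨P, hP, fun Q hQ => hQ.unique hT hP⟩

theorem IsDecayRate.hasGeomTail_numberLaw_deterministic [IsProbabilityMeasure Y] (hmu : 0 ≤ mu)
    (hT : 0 < T) (hz : IsDecayRate mu Y (Measure.dirac T) z) {P : Measure (ℕ × ℝ)}
    (hP : IsDeterministicStationary mu Y T P) :
    HasGeomTail z ((1 - z) / (serviceExponent mu Y z * T)) (numberLaw P) := by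
  obtain ⟨Q, hQ, tail⟩ := hz.exists_isDeterministicStationary hmu hT
  rwa [hP.unique hT hQ]

end Deterministic

/-! ### Decay rates for Erlang and deterministic inter-arrival times -/

section Rates

theorem monotone_one_add_div_pow {x : ℝ} (hx : 0 ≤ x) : Monotone fun k : ℕ => (1 + x / k) ^ k := by
  refine monotone_nat_of_le_succ fun k => ?_
  rcases k.eq_zero_or_pos with rfl | hk
  · simpa using hx
  have hk0 : (0 : ℝ) < k := Nat.cast_pos.2 hk
  have hxk : 0 ≤ x / (k + 1 : ℕ) := by positivity
  have bernoulli : 1 + x / k ≤ (1 + x / (k + 1 : ℕ)) ^ (((k + 1 : ℕ) : ℝ) / k) := by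
    convert one_add_mul_self_le_rpow_one_add (s := x / (k + 1 : ℕ)) (p := ((k + 1 : ℕ) : ℝ) / k)
      (by linarith) ((one_le_div hk0).2 (Nat.cast_le.2 k.le_succ)) using 2
    field_simp
  calc (1 + x / k) ^ k ≤ ((1 + x / (k + 1 : ℕ)) ^ (((k + 1 : ℕ) : ℝ) / k)) ^ k := by gcongr
    _ = (1 + x / (k + 1 : ℕ)) ^ (k + 1) := by
      rw [← Real.rpow_mul_natCast (by positivity), div_mul_cancel₀ _ hk0.ne', Real.rpow_natCast]

variable {lam mu : ℝ} {Y : Measure ℕ} {j k : ℕ} {t z : ℝ} {r : ℕ → ℝ}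

theorem isProbabilityMeasure_gammaMeasure_natCast_mul (hlam : 0 < lam) (hk : 1 ≤ k) :
    IsProbabilityMeasure (gammaMeasure k (k * lam)) :=
  have hk0 : (0 : ℝ) < k := Nat.cast_pos.2 hk
  isProbabilityMeasure_gammaMeasure hk0 (mul_pos hk0 hlam)

theorem mgf_gammaMeasure_natCast_mul (hlam : 0 < lam) (hk : 1 ≤ k) (ht : t ≤ 0) :
    mgf id (gammaMeasure k (k * lam)) t = ((1 + -t / lam / k) ^ k)⁻¹ := by
  have hk0 : (0 : ℝ) < k := Nat.cast_pos.2 hk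
  have hkl := mul_pos hk0 hlam
  have base_eq : 1 + -t / lam / k = (k * lam - t) / (k * lam) := by
    field_simp
    ring
  rw [mgf_gammaMeasure hk0 hkl (ht.trans_lt hkl), Real.rpow_natCast, base_eq, ← inv_pow, inv_div]

theorem mgf_gammaMeasure_natCast_mul_antitone (hlam : 0 < lam) (hj : 1 ≤ j) (hjk : j ≤ k)
    (ht : t ≤ 0) : mgf id (gammaMeasure k (k * lam)) t ≤ mgf id (gammaMeasure j (j * lam)) t := by
  have hx : 0 ≤ -t / lam := div_nonneg (neg_nonneg.2 ht) hlam.le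
  rw [mgf_gammaMeasure_natCast_mul hlam hj ht, mgf_gammaMeasure_natCast_mul hlam (hj.trans hjk) ht]
  exact inv_anti₀ (by positivity) (monotone_one_add_div_pow hx hjk)

theorem mgf_dirac_one_div :
    mgf id (Measure.dirac (1 / lam)) t = (Real.exp (-t / lam))⁻¹ := by
  rw [mgf_dirac', ← Real.exp_neg, neg_div, neg_neg, id, mul_one_div]

theorem mgf_dirac_le_mgf_gammaMeasure (hlam : 0 < lam) (hk : 1 ≤ k) (ht : t ≤ 0) :
    mgf id (Measure.dirac (1 / lam)) t ≤ mgf id (gammaMeasure k (k * lam)) t := by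
  have hx : 0 ≤ -t / lam := div_nonneg (neg_nonneg.2 ht) hlam.le
  have pow_le_exp : (1 + -t / lam / k) ^ k ≤ Real.exp (-t / lam) := by
    have base_le : 1 + -t / lam / k ≤ Real.exp (-t / lam / k) := by
      rw [add_comm]
      exact Real.add_one_le_exp _
    calc (1 + -t / lam / k) ^ k ≤ Real.exp (-t / lam / k) ^ k := by gcongr
      _ = Real.exp (-t / lam) := by
        rw [← Real.exp_nat_mul, mul_div_cancel₀ _ (Nat.cast_ne_zero.2 (by lia))]
  rw [mgf_dirac_one_div, mgf_gammaMeasure_natCast_mul hlam hk ht]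
  exact inv_anti₀ (by positivity) pow_le_exp

theorem tendsto_mgf_gammaMeasure (hlam : 0 < lam) {s : ℕ → ℝ} (hs : ∀ᶠ k in atTop, s k ≤ 0)
    (hst : Tendsto s atTop (𝓝 t)) :
    Tendsto (fun k : ℕ => mgf id (gammaMeasure k (k * lam)) (s k)) atTop
      (𝓝 (mgf id (Measure.dirac (1 / lam)) t)) := by
  have pow_tendsto : Tendsto (fun k : ℕ => (1 + -s k / lam / k) ^ k) atTop
      (𝓝 (Real.exp (-t / lam))) := by
    refine Real.tendsto_one_add_pow_exp_of_tendsto ((hst.neg.div_const lam).congr' ?_)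
    filter_upwards [eventually_ne_atTop 0] with k hk
    field_simp
  rw [mgf_dirac_one_div]
  refine (pow_tendsto.inv₀ (Real.exp_pos _).ne').congr' ?_
  filter_upwards [eventually_ge_atTop 1, hs] with k hk hsk
  exact (mgf_gammaMeasure_natCast_mul hlam hk hsk).symm

-- Fatou's lemma as `z ↑ 1`, using `1 - z ^ j = (1 - z) * ∑ i < j, z ^ i`.
theorem exists_mul_one_sub_le_mul_serviceExponent [IsProbabilityMeasure Y] (hmu : 0 < mu)
    (hstable : ENNReal.ofReal lam < ENNReal.ofReal mu * ∫⁻ j, (j : ℝ≥0∞) ∂Y) :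
    ∃ z ∈ Set.Ioo (0 : ℝ) 1, lam * (1 - z) ≤ z * serviceExponent mu Y z := by
  set f : ℝ → ℕ → ℝ≥0∞ := fun z j => ENNReal.ofReal (mu * (z * ∑ i ∈ Finset.range j, z ^ i)) with hf
  have liminf_eq (j : ℕ) : liminf (fun z => f z j) (𝓝[<] 1) = ENNReal.ofReal mu * j := by
    have continuous : Continuous fun z => f z j :=
      ENNReal.continuous_ofReal.comp (by fun_prop)
    have tendsto := (continuous.tendsto 1).mono_left (nhdsWithin_le_nhds (s := Set.Iio 1))
    rw [tendsto.liminf_eq]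
    simp [hf, ENNReal.ofReal_mul hmu.le]
  have lt_liminf : ENNReal.ofReal lam < liminf (fun z => ∫⁻ j, f z j ∂Y) (𝓝[<] 1) := by
    refine hstable.trans_le ?_
    rw [← lintegral_const_mul _ .of_discrete]
    simp_rw [← liminf_eq]
    exact lintegral_liminf_le fun z => .of_discrete
  obtain ⟨z, hlt, hz⟩ := ((eventually_lt_of_lt_liminf lt_liminf).and
    (Ioo_mem_nhdsLT zero_lt_one)).exists
  refine ⟨z, hz, ?_⟩
  have hz1 := sub_nonneg.2 hz.2.le
  have one_sub_mul_lintegral : ENNReal.ofReal (1 - z) * ∫⁻ j, f z j ∂Y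
      = ENNReal.ofReal (z * serviceExponent mu Y z) := by
    have integrand (j : ℕ) : ENNReal.ofReal (1 - z) * f z j
        = ENNReal.ofReal (z * mu * (1 - z ^ j)) := by
      rw [hf, ← ENNReal.ofReal_mul hz1, ← mul_neg_geom_sum]
      ring_nf
    rw [← lintegral_const_mul _ .of_discrete]
    simp_rw [integrand]
    rw [← ofReal_integral_eq_lintegral_ofReal]
    · rw [integral_const_mul, integral_sub (integrable_const 1) (integrable_pow hz.1.le hz.2.le)]
      simp [serviceExponent, batchPgf, mul_assoc]
    · exact ((integrable_const 1).sub (integrable_pow hz.1.le hz.2.le)).const_mul _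
    · exact ae_of_all _ fun j => mul_nonneg (mul_pos hz.1 hmu).le
        (sub_nonneg.2 (pow_le_one₀ hz.1.le hz.2.le))
  have hγ := serviceExponent_nonneg (Y := Y) hmu.le hz.1.le hz.2.le
  rw [← ENNReal.ofReal_le_ofReal_iff (mul_nonneg hz.1.le hγ), mul_comm lam, ENNReal.ofReal_mul hz1,
    ← one_sub_mul_lintegral]
  gcongr

theorem exists_isDecayRate_gammaMeasure [IsProbabilityMeasure Y] (hlam : 0 < lam) (hmu : 0 < mu)
    (hstable : ENNReal.ofReal lam < ENNReal.ofReal mu * ∫⁻ j, (j : ℝ≥0∞) ∂Y) (hk : 1 ≤ k) :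
    ∃ z, IsDecayRate mu Y (gammaMeasure k (k * lam)) z := by
  obtain ⟨z, hz, hle⟩ := exists_mul_one_sub_le_mul_serviceExponent hmu hstable
  have hγ := serviceExponent_nonneg (Y := Y) hmu.le hz.1.le hz.2.le
  have := isProbabilityMeasure_gammaMeasure_natCast_mul hlam hk
  have mgf_one_le :
      mgf id (gammaMeasure (1 : ℕ) ((1 : ℕ) * lam)) (-serviceExponent mu Y z) ≤ z := by
    rw [mgf_gammaMeasure_natCast_mul hlam le_rfl (neg_nonpos.2 hγ), neg_neg, pow_one, Nat.cast_one,
      div_one, inv_le_comm₀ (by positivity) hz.1, ← one_div, div_le_iff₀ hz.1]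
    field_simp
    linarith
  have mgf_le := (mgf_gammaMeasure_natCast_mul_antitone hlam le_rfl hk (neg_nonpos.2 hγ)).trans
    mgf_one_le
  obtain ⟨w, -, hw⟩ := exists_isDecayRate_le hmu.le (ae_nonneg_gammaMeasure _ _) hz.1.le hz.2 mgf_le
  exact ⟨w, hw⟩

theorem ae_nonneg_dirac_one_div (hlam : 0 < lam) : ∀ᵐ a ∂(Measure.dirac (1 / lam)), 0 ≤ a :=
  (ae_dirac_iff measurableSet_Ici).2 (one_div_pos.2 hlam).le

theorem IsDecayRate.exists_dirac_le [IsProbabilityMeasure Y] (hlam : 0 < lam) (hmu : 0 ≤ mu)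
    (hk : 1 ≤ k) (hz : IsDecayRate mu Y (gammaMeasure k (k * lam)) z) :
    ∃ w ≤ z, IsDecayRate mu Y (Measure.dirac (1 / lam)) w := by
  have := isProbabilityMeasure_gammaMeasure_natCast_mul hlam hk
  refine exists_isDecayRate_le hmu (ae_nonneg_dirac_one_div hlam) hz.pos.le hz.lt_one ?_
  exact (mgf_dirac_le_mgf_gammaMeasure hlam hk (neg_nonpos.2 (hz.serviceExponent_pos hmu).le)).trans
    hz.mgf_eq.le

theorem IsDecayRate.dirac_le [IsProbabilityMeasure Y] (hlam : 0 < lam) (hmu : 0 ≤ mu)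
    (hk : 1 ≤ k) (hz : IsDecayRate mu Y (gammaMeasure k (k * lam)) z) {w : ℝ}
    (hw : IsDecayRate mu Y (Measure.dirac (1 / lam)) w) : w ≤ z :=
  have := isProbabilityMeasure_gammaMeasure_natCast_mul hlam hk
  hz.le_of_mgf_le hw hmu (ae_nonneg_dirac_one_div hlam) fun _ ht =>
    mgf_dirac_le_mgf_gammaMeasure hlam hk ht

theorem IsDecayRate.gammaMeasure_le [IsProbabilityMeasure Y] (hlam : 0 < lam) (hmu : 0 ≤ mu)
    (hj : 1 ≤ j) (hjk : j ≤ k) (hz : IsDecayRate mu Y (gammaMeasure j (j * lam)) z) {w : ℝ}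
    (hw : IsDecayRate mu Y (gammaMeasure k (k * lam)) w) : w ≤ z :=
  have := isProbabilityMeasure_gammaMeasure_natCast_mul hlam hj
  have := isProbabilityMeasure_gammaMeasure_natCast_mul hlam (hj.trans hjk)
  hz.le_of_mgf_le hw hmu (ae_nonneg_gammaMeasure _ _) fun _ ht =>
    mgf_gammaMeasure_natCast_mul_antitone hlam hj hjk ht

theorem tendsto_decayRate [IsProbabilityMeasure Y] (hlam : 0 < lam) (hmu : 0 ≤ mu)
    (hr : ∀ k : ℕ, 1 ≤ k → IsDecayRate mu Y (gammaMeasure k (k * lam)) (r k))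
    (hz : IsDecayRate mu Y (Measure.dirac (1 / lam)) z) : Tendsto r atTop (𝓝 z) := by
  have z_le (k : ℕ) (hk : 1 ≤ k) : z ≤ r k := (hr k hk).dirac_le hlam hmu hk hz
  obtain ⟨w, tendsto_w⟩ : ∃ w, Tendsto r atTop (𝓝 w) := by
    have antitone : Antitone fun k => r (k + 1) := fun j k hjk =>
      (hr (j + 1) j.succ_pos).gammaMeasure_le hlam hmu j.succ_pos (by lia) (hr (k + 1) k.succ_pos)
    have bounded : BddBelow (Set.range fun k => r (k + 1)) :=
      ⟨z, by rintro _ ⟨k, rfl⟩; exact z_le _ k.succ_pos⟩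
    exact ⟨_, (tendsto_add_atTop_iff_nat 1).1 (tendsto_atTop_ciInf antitone bounded)⟩
  have ge_z : z ≤ w := ge_of_tendsto tendsto_w ((eventually_ge_atTop 1).mono z_le)
  have le_one : w ≤ r 1 := le_of_tendsto tendsto_w <| (eventually_ge_atTop 1).mono fun k hk =>
    (hr 1 le_rfl).gammaMeasure_le hlam hmu le_rfl hk (hr k hk)
  have lt_one : w < 1 := le_one.trans_lt (hr 1 le_rfl).lt_one
  have exponent_tendsto : Tendsto (fun k => -serviceExponent mu Y (r k)) atTop
      (𝓝 (-serviceExponent mu Y w)) :=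
    ((continuousOn_serviceExponent w ⟨hz.pos.le.trans ge_z, lt_one.le⟩).tendsto.comp
      (tendsto_nhdsWithin_iff.2 ⟨tendsto_w, (eventually_ge_atTop 1).mono fun k hk =>
        ⟨(hr k hk).pos.le, (hr k hk).lt_one.le⟩⟩)).neg
  have mgf_tendsto := tendsto_mgf_gammaMeasure hlam ((eventually_ge_atTop 1).mono fun k hk =>
    neg_nonpos.2 (serviceExponent_nonneg hmu (hr k hk).pos.le (hr k hk).lt_one.le)) exponent_tendsto
  have w_rate : IsDecayRate mu Y (Measure.dirac (1 / lam)) w :=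
    ⟨hz.pos.trans_le ge_z, lt_one, tendsto_nhds_unique mgf_tendsto
      (tendsto_w.congr' ((eventually_ge_atTop 1).mono fun k hk => (hr k hk).mgf_eq.symm))⟩
  rwa [hz.unique w_rate hmu (ae_nonneg_dirac_one_div hlam)]

end Rates

/-! ### Performance measures as functions of the decay rate -/

section Performance

variable {ι : Type*} {l : Filter ι} {lam mu : ℝ} {Y p p' α α' : Measure ℕ} {z w : ℝ}
  {r : ι → ℝ} {ps αs : ι → Measure ℕ}

theorem mul_two_mul_sub_one_sub_sq_mono {a b x y : ℝ} (ha : 1 ≤ a) (hab : a ≤ b)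
    (hxy : x ≤ y) (hy : 0 ≤ y) (hxa : x ≤ a) (hyb : y ≤ b) (hmul : y * a ≤ x * b) :
    x * (2 * a - 1) - x ^ 2 ≤ y * (2 * b - 1) - y ^ 2 := by
  have cross : 0 ≤ (y - x) * (a + b - x - y) := mul_nonneg (by linarith) (by linarith)
  have gap : 0 ≤ y * (b - a) := mul_nonneg hy (by linarith)
  have diff : y - x ≤ x * (b - a) := by
    have : y - x ≤ (y - x) * a := le_mul_of_one_le_right (by linarith) ha
    linarith
  linarith

/-- The laws `p` of the number of customers in the system and `α` of the number of customers found
by an arriving customer decay geometrically with the same rate `z`. The tail constant of `p` is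
such that `p` has mean `lam / serviceExponent mu Y z`. -/
structure HasQueueLaws (lam mu : ℝ) (Y : Measure ℕ) (z : ℝ) (p α : Measure ℕ) : Prop where
  pos : 0 < z
  lt_one : z < 1
  serviceExponent_pos : 0 < serviceExponent mu Y z
  number : HasGeomTail z (lam / serviceExponent mu Y z * (1 - z)) p
  arrival : HasGeomTail z z α

namespace HasQueueLaws

theorem stochLE [IsProbabilityMeasure Y] (h : HasQueueLaws lam mu Y z p α)
    (h' : HasQueueLaws lam mu Y w p' α') (hzw : z ≤ w) (hY : Y {1} = 1) : StochLE p p' := by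
  have tail_eq {x : ℝ} (hx : x < 1) : lam / serviceExponent mu Y x * (1 - x) = lam / mu := by
    have := (sub_pos.2 hx).ne'
    rw [serviceExponent_of_singleton_one hY]
    field_simp
  exact (tail_eq h.lt_one ▸ h.number).stochLE (tail_eq h'.lt_one ▸ h'.number) h.pos.le hzw

theorem memLp_two (h : HasQueueLaws lam mu Y z p α) : MemLp (fun n : ℕ => (n : ℝ)) 2 p :=
  h.number.memLp_two h.pos.le h.lt_one

theorem meanNumber_eq (h : HasQueueLaws lam mu Y z p α) :
    meanNumber p = lam / serviceExponent mu Y z := by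
  rw [h.number.meanNumber_eq h.pos.le h.lt_one, mul_div_cancel_right₀ _ (sub_pos.2 h.lt_one).ne']

theorem varNumber_eq (h : HasQueueLaws lam mu Y z p α) :
    varNumber p = lam / serviceExponent mu Y z * (2 * (1 - z)⁻¹ - 1)
      - (lam / serviceExponent mu Y z) ^ 2 := by
  have hz := (sub_pos.2 h.lt_one).ne'
  rw [h.number.varNumber_eq h.pos.le h.lt_one, mul_div_cancel_right₀ _ hz]
  field_simp
  ring

theorem meanSojourn_eq [IsProbabilityMeasure Y] (h : HasQueueLaws lam mu Y z p α) (hmu : 0 ≤ mu) :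
    meanSojourn mu Y α = ENNReal.ofReal (1 / serviceExponent mu Y z) :=
  h.arrival.meanSojourn_eq hmu h.pos.le h.lt_one.le h.serviceExponent_pos

theorem meanSojourn_ne_top [IsProbabilityMeasure Y] (h : HasQueueLaws lam mu Y z p α)
    (hmu : 0 ≤ mu) : meanSojourn mu Y α ≠ ∞ :=
  h.meanSojourn_eq hmu ▸ ENNReal.ofReal_ne_top

theorem serviceExponent_le [IsFiniteMeasure Y] (h : HasQueueLaws lam mu Y z p α)
    (h' : HasQueueLaws lam mu Y w p' α') (hmu : 0 ≤ mu) (hzw : z ≤ w) :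
    serviceExponent mu Y w ≤ serviceExponent mu Y z :=
  antitoneOn_serviceExponent hmu ⟨h.pos.le, h.lt_one.le⟩ ⟨h'.pos.le, h'.lt_one.le⟩ hzw

theorem meanNumber_le [IsFiniteMeasure Y] (h : HasQueueLaws lam mu Y z p α)
    (h' : HasQueueLaws lam mu Y w p' α') (hlam : 0 ≤ lam) (hmu : 0 ≤ mu) (hzw : z ≤ w) :
    meanNumber p ≤ meanNumber p' := by
  rw [h.meanNumber_eq, h'.meanNumber_eq]
  exact div_le_div_of_nonneg_left hlam h'.serviceExponent_pos (h.serviceExponent_le h' hmu hzw)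

theorem meanSojourn_le [IsProbabilityMeasure Y] (h : HasQueueLaws lam mu Y z p α)
    (h' : HasQueueLaws lam mu Y w p' α') (hmu : 0 ≤ mu) (hzw : z ≤ w) :
    meanSojourn mu Y α ≤ meanSojourn mu Y α' := by
  rw [h.meanSojourn_eq hmu, h'.meanSojourn_eq hmu]
  exact ENNReal.ofReal_le_ofReal
    (one_div_le_one_div_of_le h'.serviceExponent_pos (h.serviceExponent_le h' hmu hzw))

theorem varNumber_le [IsProbabilityMeasure Y] (h : HasQueueLaws lam mu Y z p α)
    (h' : HasQueueLaws lam mu Y w p' α') (hlam : 0 ≤ lam) (hmu : 0 ≤ mu) (hzw : z ≤ w) :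
    varNumber p ≤ varNumber p' := by
  have hz := sub_pos.2 h.lt_one
  have hw := sub_pos.2 h'.lt_one
  have hγz := h.serviceExponent_pos
  have hγw := h'.serviceExponent_pos
  have tail_le :
      lam / serviceExponent mu Y w * (1 - w) ≤ lam / serviceExponent mu Y z * (1 - z) := by
    have slope_le := serviceExponent_div_one_sub_le (Y := Y) hmu h.pos.le hzw h'.lt_one
    have := div_pos hγz hz
    calc lam / serviceExponent mu Y w * (1 - w) = lam / (serviceExponent mu Y w / (1 - w)) := by
          field_simp
      _ ≤ lam / (serviceExponent mu Y z / (1 - z)) := by gcongr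
      _ = lam / serviceExponent mu Y z * (1 - z) := by field_simp
  have mean_le {x : ℝ} {q β : Measure ℕ} (hx : HasQueueLaws lam mu Y x q β) :
      lam / serviceExponent mu Y x ≤ (1 - x)⁻¹ :=
    (le_inv_mul_iff₀' (sub_pos.2 hx.lt_one)).2 hx.number.le_one |>.trans_eq (mul_one _)
  rw [h.varNumber_eq, h'.varNumber_eq]
  refine mul_two_mul_sub_one_sub_sq_mono ((one_le_inv₀ hz).2 (by linarith [h.pos]))
    (inv_anti₀ hw (by linarith)) ?_ (div_nonneg hlam hγw.le) (mean_le h) (mean_le h') ?_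
  · simpa only [h.meanNumber_eq, h'.meanNumber_eq] using h.meanNumber_le h' hlam hmu hzw
  · rw [← div_eq_mul_inv, ← div_eq_mul_inv, div_le_div_iff₀ hz hw]
    exact tail_le

theorem tendsto_serviceExponent [IsFiniteMeasure Y] (h : HasQueueLaws lam mu Y z p α)
    (hr : Tendsto r l (𝓝 z)) :
    Tendsto (fun i => serviceExponent mu Y (r i)) l (𝓝 (serviceExponent mu Y z)) :=
  (continuousOn_serviceExponent.continuousAt (Icc_mem_nhds h.pos h.lt_one)).tendsto.comp hr

theorem tendsto_meanNumber [IsFiniteMeasure Y] (h : HasQueueLaws lam mu Y z p α)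
    (hs : ∀ᶠ i in l, HasQueueLaws lam mu Y (r i) (ps i) (αs i)) (hr : Tendsto r l (𝓝 z)) :
    Tendsto (fun i => meanNumber (ps i)) l (𝓝 (meanNumber p)) := by
  rw [h.meanNumber_eq]
  exact (tendsto_const_nhds.div (h.tendsto_serviceExponent hr) h.serviceExponent_pos.ne').congr'
    (hs.mono fun i hi => hi.meanNumber_eq.symm)

theorem tendsto_meanSojourn [IsProbabilityMeasure Y] (h : HasQueueLaws lam mu Y z p α)
    (hmu : 0 ≤ mu) (hs : ∀ᶠ i in l, HasQueueLaws lam mu Y (r i) (ps i) (αs i))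
    (hr : Tendsto r l (𝓝 z)) :
    Tendsto (fun i => meanSojourn mu Y (αs i)) l (𝓝 (meanSojourn mu Y α)) := by
  rw [h.meanSojourn_eq hmu]
  exact (ENNReal.tendsto_ofReal (tendsto_const_nhds.div (h.tendsto_serviceExponent hr)
    h.serviceExponent_pos.ne')).congr' (hs.mono fun i hi => (hi.meanSojourn_eq hmu).symm)

theorem tendsto_varNumber [IsFiniteMeasure Y] (h : HasQueueLaws lam mu Y z p α)
    (hs : ∀ᶠ i in l, HasQueueLaws lam mu Y (r i) (ps i) (αs i)) (hr : Tendsto r l (𝓝 z)) :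
    Tendsto (fun i => varNumber (ps i)) l (𝓝 (varNumber p)) := by
  have mean := tendsto_const_nhds (x := lam).div (h.tendsto_serviceExponent hr)
    h.serviceExponent_pos.ne'
  have inv := (hr.const_sub 1).inv₀ (sub_pos.2 h.lt_one).ne'
  rw [h.varNumber_eq]
  exact ((mean.mul ((inv.const_mul 2).sub_const 1)).sub (mean.pow 2)).congr'
    (hs.mono fun i hi => hi.varNumber_eq.symm)

end HasQueueLaws

variable {k : ℕ}

theorem IsDecayRate.hasQueueLaws_erlang [IsProbabilityMeasure Y] (hlam : 0 < lam) (hmu : 0 < mu)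
    (hk : 1 ≤ k) (hz : IsDecayRate mu Y (gammaMeasure k (k * lam)) z) {P : Measure (ℕ × Fin k)}
    (hP : IsErlangStationary lam mu Y k P)
    (hα : IsArrivalStationary mu Y (gammaMeasure k (k * lam)) α) :
    HasQueueLaws lam mu Y z (numberLaw P) α :=
  have : NeZero k := .of_pos hk
  have := isProbabilityMeasure_gammaMeasure_natCast_mul hlam hk
  ⟨hz.pos, hz.lt_one, hz.serviceExponent_pos hmu.le, hz.hasGeomTail_numberLaw_erlang hlam hmu hP,
    hz.hasGeomTail hmu.le (ae_nonneg_gammaMeasure _ _) hα⟩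

theorem IsDecayRate.hasQueueLaws_deterministic [IsProbabilityMeasure Y] (hlam : 0 < lam)
    (hmu : 0 ≤ mu) (hz : IsDecayRate mu Y (Measure.dirac (1 / lam)) z) {P : Measure (ℕ × ℝ)}
    (hP : IsDeterministicStationary mu Y (1 / lam) P)
    (hα : IsArrivalStationary mu Y (Measure.dirac (1 / lam)) α) :
    HasQueueLaws lam mu Y z (numberLaw P) α where
  pos := hz.pos
  lt_one := hz.lt_one
  serviceExponent_pos := hz.serviceExponent_pos hmu
  number := by
    have tail := hz.hasGeomTail_numberLaw_deterministic hmu (one_div_pos.2 hlam) hP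
    convert tail using 1
    field_simp
  arrival := hz.hasGeomTail hmu (ae_nonneg_dirac_one_div hlam) hα

end Performance

theorem ofReal_lt_ofReal_mul_lintegral_natCast {lam mu : ℝ} (hlam : 0 ≤ lam) (hmu : 0 ≤ mu)
    {Y : Measure ℕ} (h : lam < mu * ∫ j, (j : ℝ) ∂Y) :
    ENNReal.ofReal lam < ENNReal.ofReal mu * ∫⁻ j, (j : ℝ≥0∞) ∂Y := by
  rw [integral_eq_lintegral_of_nonneg_ae (.of_forall fun j => j.cast_nonneg)
    Measurable.of_discrete.aestronglyMeasurable] at h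
  simp only [ENNReal.ofReal_natCast] at h
  calc ENNReal.ofReal lam < ENNReal.ofReal (mu * (∫⁻ j, (j : ℝ≥0∞) ∂Y).toReal) :=
        (ENNReal.ofReal_lt_ofReal_iff_of_nonneg hlam).2 h
    _ = ENNReal.ofReal mu * ENNReal.ofReal (∫⁻ j, (j : ℝ≥0∞) ∂Y).toReal :=
        ENNReal.ofReal_mul hmu
    _ ≤ ENNReal.ofReal mu * ∫⁻ j, (j : ℝ≥0∞) ∂Y := by
        gcongr
        exact ENNReal.ofReal_toReal_le

end BatchQueue

end

open BatchQueue in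
theorem mainTheorem7_general (lam mu : ℝ) (hlam : 0 < lam) (hmu : 0 < mu)
    (Y : Measure ℕ) [IsProbabilityMeasure Y]
    (hstable : ENNReal.ofReal lam < ENNReal.ofReal mu * ∫⁻ j, (j : ℝ≥0∞) ∂Y) :
    (∀ k : ℕ, 1 ≤ k → ∃! P, IsErlangStationary lam mu Y k P) ∧
    (∀ k : ℕ, 1 ≤ k → ∃! α, IsArrivalStationary mu Y (gammaMeasure k (k * lam)) α) ∧
    (∃! P, IsDeterministicStationary mu Y (1 / lam) P) ∧
    (∃! α, IsArrivalStationary mu Y (Measure.dirac (1 / lam)) α) ∧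
    ∀ (P : ∀ k : ℕ, Measure (ℕ × Fin k)) (α : ℕ → Measure ℕ)
      (PD : Measure (ℕ × ℝ)) (αD : Measure ℕ),
      (∀ k : ℕ, 1 ≤ k → IsErlangStationary lam mu Y k (P k)) →
      (∀ k : ℕ, 1 ≤ k → IsArrivalStationary mu Y (gammaMeasure k (k * lam)) (α k)) →
      IsDeterministicStationary mu Y (1 / lam) PD →
      IsArrivalStationary mu Y (Measure.dirac (1 / lam)) αD →
      (Y {1} = 1 → ∀ k : ℕ, 1 ≤ k →
        StochLE (numberLaw PD) (numberLaw (P (k + 1))) ∧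
        StochLE (numberLaw (P (k + 1))) (numberLaw (P k))) ∧
      (∀ k : ℕ, 1 ≤ k → MemLp (fun n : ℕ => (n : ℝ)) 2 (numberLaw (P k))) ∧
      MemLp (fun n : ℕ => (n : ℝ)) 2 (numberLaw PD) ∧
      (∀ k : ℕ, 1 ≤ k → meanSojourn mu Y (α k) ≠ ∞) ∧
      meanSojourn mu Y αD ≠ ∞ ∧
      (∀ k : ℕ, 1 ≤ k → meanNumber (numberLaw (P (k + 1))) ≤ meanNumber (numberLaw (P k))) ∧
      Tendsto (fun k => meanNumber (numberLaw (P k))) atTop (𝓝 (meanNumber (numberLaw PD))) ∧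
      (∀ k : ℕ, 1 ≤ k → meanSojourn mu Y (α (k + 1)) ≤ meanSojourn mu Y (α k)) ∧
      Tendsto (fun k => meanSojourn mu Y (α k)) atTop (𝓝 (meanSojourn mu Y αD)) ∧
      (∀ k : ℕ, 1 ≤ k → varNumber (numberLaw (P (k + 1))) ≤ varNumber (numberLaw (P k))) ∧
      Tendsto (fun k => varNumber (numberLaw (P k))) atTop (𝓝 (varNumber (numberLaw PD))) := by
  choose! r hr using fun k (hk : 1 ≤ k) => exists_isDecayRate_gammaMeasure hlam hmu hstable hk
  obtain ⟨z, -, hz⟩ := (hr 1 le_rfl).exists_dirac_le hlam hmu.le le_rfl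
  refine ⟨fun k hk =>
      have : NeZero k := .of_pos hk
      (hr k hk).existsUnique_isErlangStationary hlam hmu,
    fun k hk =>
      have := isProbabilityMeasure_gammaMeasure_natCast_mul hlam hk
      (hr k hk).existsUnique_isArrivalStationary hmu.le (ae_nonneg_gammaMeasure _ _),
    hz.existsUnique_isDeterministicStationary hmu.le (one_div_pos.2 hlam),
    hz.existsUnique_isArrivalStationary hmu.le (ae_nonneg_dirac_one_div hlam),
    fun P α PD αD hP hα hPD hαD => ?_⟩
  have laws (k : ℕ) (hk : 1 ≤ k) : HasQueueLaws lam mu Y (r k) (numberLaw (P k)) (α k) :=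
    (hr k hk).hasQueueLaws_erlang hlam hmu hk (hP k hk) (hα k hk)
  have lawsD : HasQueueLaws lam mu Y z (numberLaw PD) αD :=
    hz.hasQueueLaws_deterministic hlam hmu.le hPD hαD
  have succ (k : ℕ) := laws (k + 1) k.succ_pos
  have anti (k : ℕ) (hk : 1 ≤ k) : r (k + 1) ≤ r k :=
    (hr k hk).gammaMeasure_le hlam hmu.le hk k.le_succ (hr (k + 1) k.succ_pos)
  have dirac_le (k : ℕ) : z ≤ r (k + 1) :=
    (hr (k + 1) k.succ_pos).dirac_le hlam hmu.le k.succ_pos hz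
  have limit : Tendsto r atTop (𝓝 z) := tendsto_decayRate hlam hmu.le hr hz
  have large : ∀ᶠ k in atTop, HasQueueLaws lam mu Y (r k) (numberLaw (P k)) (α k) :=
    (eventually_ge_atTop 1).mono laws
  exact ⟨fun hY k hk => ⟨lawsD.stochLE (succ k) (dirac_le k) hY,
      (succ k).stochLE (laws k hk) (anti k hk) hY⟩,
    fun k hk => (laws k hk).memLp_two, lawsD.memLp_two,
    fun k hk => (laws k hk).meanSojourn_ne_top hmu.le, lawsD.meanSojourn_ne_top hmu.le,
    fun k hk => (succ k).meanNumber_le (laws k hk) hlam.le hmu.le (anti k hk),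
    lawsD.tendsto_meanNumber large limit,
    fun k hk => (succ k).meanSojourn_le (laws k hk) hmu.le (anti k hk),
    lawsD.tendsto_meanSojourn hmu.le large limit,
    fun k hk => (succ k).varNumber_le (laws k hk) hlam.le hmu.le (anti k hk),
    lawsD.tendsto_varNumber large limit⟩

theorem mainTheorem7 (lam mu : ℝ) (hlam : 0 < lam) (hmu : 0 < mu)
    (b : ℕ) (Y : Measure ℕ) [IsProbabilityMeasure Y]
    (hY : ∀ᵐ j ∂Y, 1 ≤ j ∧ j ≤ b)
    (hstable : lam < mu * ∫ j, (j : ℝ) ∂Y) :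
    -- the stationary laws exist and are unique
    (∀ k : ℕ, 1 ≤ k → ∃! P, BatchQueue.IsErlangStationary lam mu Y k P) ∧
    (∀ k : ℕ, 1 ≤ k → ∃! α, BatchQueue.IsArrivalStationary mu Y (gammaMeasure k (k * lam)) α) ∧
    (∃! P, BatchQueue.IsDeterministicStationary mu Y (1 / lam) P) ∧
    (∃! α, BatchQueue.IsArrivalStationary mu Y (Measure.dirac (1 / lam)) α) ∧
    ∀ (P : ∀ k : ℕ, Measure (ℕ × Fin k)) (α : ℕ → Measure ℕ)
      (PD : Measure (ℕ × ℝ)) (αD : Measure ℕ),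
      (∀ k : ℕ, 1 ≤ k → BatchQueue.IsErlangStationary lam mu Y k (P k)) →
      (∀ k : ℕ, 1 ≤ k →
        BatchQueue.IsArrivalStationary mu Y (gammaMeasure k (k * lam)) (α k)) →
      BatchQueue.IsDeterministicStationary mu Y (1 / lam) PD →
      BatchQueue.IsArrivalStationary mu Y (Measure.dirac (1 / lam)) αD →
      -- stochastic order when all batches have size one
      (Y {1} = 1 → ∀ k : ℕ, 1 ≤ k →
        BatchQueue.StochLE (BatchQueue.numberLaw PD) (BatchQueue.numberLaw (P (k + 1))) ∧
        BatchQueue.StochLE (BatchQueue.numberLaw (P (k + 1))) (BatchQueue.numberLaw (P k))) ∧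
      -- the means, variances and expected sojourn times are finite
      (∀ k : ℕ, 1 ≤ k → MemLp (fun n : ℕ => (n : ℝ)) 2 (BatchQueue.numberLaw (P k))) ∧
      MemLp (fun n : ℕ => (n : ℝ)) 2 (BatchQueue.numberLaw PD) ∧
      (∀ k : ℕ, 1 ≤ k → BatchQueue.meanSojourn mu Y (α k) ≠ ∞) ∧
      BatchQueue.meanSojourn mu Y αD ≠ ∞ ∧
      -- the mean number of customers decreases to its value for deterministic arrivals
      (∀ k : ℕ, 1 ≤ k →
        BatchQueue.meanNumber (BatchQueue.numberLaw (P (k + 1))) ≤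
          BatchQueue.meanNumber (BatchQueue.numberLaw (P k))) ∧
      Tendsto (fun k => BatchQueue.meanNumber (BatchQueue.numberLaw (P k))) atTop
        (𝓝 (BatchQueue.meanNumber (BatchQueue.numberLaw PD))) ∧
      -- so does the expected sojourn time
      (∀ k : ℕ, 1 ≤ k →
        BatchQueue.meanSojourn mu Y (α (k + 1)) ≤ BatchQueue.meanSojourn mu Y (α k)) ∧
      Tendsto (fun k => BatchQueue.meanSojourn mu Y (α k)) atTop
        (𝓝 (BatchQueue.meanSojourn mu Y αD)) ∧
      -- so does the variance of the number of customers
      (∀ k : ℕ, 1 ≤ k →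
        BatchQueue.varNumber (BatchQueue.numberLaw (P (k + 1))) ≤
          BatchQueue.varNumber (BatchQueue.numberLaw (P k))) ∧
      Tendsto (fun k => BatchQueue.varNumber (BatchQueue.numberLaw (P k))) atTop
        (𝓝 (BatchQueue.varNumber (BatchQueue.numberLaw PD))) :=
  mainTheorem7_general lam mu hlam hmu Y
    (BatchQueue.ofReal_lt_ofReal_mul_lintegral_natCast hlam.le hmu.le hstable)
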